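/- Let $d\in\mathbf N$. Write $\langle x\rangle=(1+|x|^2)^{1/2}$, and let $(\cdot,\cdot)$ denote the action of $\mathscr S'(\mathbf R^d)$ on $\mathscr S(\mathbf R^d)$ that is conjugate linear in the second argument and extends the $L^2$ inner product. For $u\in\mathscr S'(\mathbf R^d)$ and $\psi\in\mathscr S(\mathbf R^d)$ let $$V_\psi u(x,\xi)=(u,M_\xi T_x\psi),\qquad M_\xi T_x\psi(y)=e^{i\langle y,\xi\rangle}\psi(y-x),\qquad x,\xi\in\mathbf R^d,$$ be the short-time Fourier transform. Gabor wave front set: fix a window $\varphi\in\mathscr S(\mathbf R^d)\setminus\{0\}$. A point $z_0\in T^*\mathbf R^d\setminus 0=\mathbf R^{2d}\setminus\{0\}$ satisfies $z_0\notin \mathrm{WF}_G(u)$ if there is an open conic set $\Gamma\subseteq T^*\mathbf R^d\setminus 0$ with $z_0\in\Gamma$ and $\sup_{z\in\Gamma}\langle z\rangle^N|V_\varphi u(z)|<\infty$ for all $N\ge 0$; $\mathrm{WF}_G(u)$ is the set of the remaining points $z_0 \neq 0$. Classical wave front set: a point $(x_0,\xi_0)$ with $\xi_0\neq 0$ satisfies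 $(x_0,\xi_0)\notin\mathrm{WF}(u)$ if there are $\chi\in C_c^\infty(\mathbf R^d)$ with $\chi(0)\neq0$ and an open conic set $\Gamma_2\subseteq\mathbf R^d\setminus 0$ with $\xi_0\in\Gamma_2$ such that $\sup_{\xi\in\Gamma_2}\langle\xi\rangle^N|V_\chi u(x_0,\xi)|<\infty$ for all $N\ge0$; $\mathrm{WF}(u)$ is the set of the remaining points $(x_0,\xi_0)$ with $\xi_0\ne 0$. Let $\pi_2(x,\xi)=\xi$. **Proposition.** Let $u\in\mathscr E'(\mathbf R^d)+\mathscr S(\mathbf R^d)$, that is, $u\in\mathscr S'(\mathbf R^d)$ is the sum of a compactly supported distribution and a Schwartz function. Then, for every choice of the window $\varphi\in\mathscr S(\mathbf R^d)\setminus\{0\}$ in the definition of $\mathrm{WF}_G$, $$\mathrm{WF}_G(u)\subseteq\{0\}\times\pi_2\mathrm{WF}(u).$$ -/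

import Mathlib

open scoped SchwartzMap Pointwise

noncomputable section

namespace GaborWF

/-- The configuration space `ℝ^d` with its Euclidean norm and inner product. -/
abbrev Rd (d : ℕ) : Type := EuclideanSpace ℝ (Fin d)

/-- The phase space `T^*ℝ^d = ℝ^d × ℝ^d`, with points `z = (x, ξ)`. The topology is the product
topology; Euclidean lengths in phase space are always written out explicitly, see `bracket₂`. -/
abbrev PhaseSpace (d : ℕ) : Type := Rd d × Rd d

/-- The Japanese bracket `⟨x⟩ = √(1 + |x|²)` on `ℝ^d`. -/
def bracket {d : ℕ} (x : Rd d) : ℝ := √(1 + ‖x‖ ^ 2)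

/-- The Japanese bracket `⟨(x, ξ)⟩ = √(1 + |x|² + |ξ|²)` on phase space. -/
def bracket₂ {d : ℕ} (z : PhaseSpace d) : ℝ := √(1 + (‖z.1‖ ^ 2 + ‖z.2‖ ^ 2))

/-- An open conic subset of `V ∖ {0}`. -/
structure IsOpenCone {V : Type*} [AddCommGroup V] [Module ℝ V] [TopologicalSpace V]
    (Γ : Set V) : Prop where
  isOpen : IsOpen Γ
  zero_notMem : (0 : V) ∉ Γ
  smul_mem : ∀ z ∈ Γ, ∀ t : ℝ, 0 < t → t • z ∈ Γ

/-- The character `y ↦ e^{i⟨y, ξ⟩}`. -/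
def character {d : ℕ} (ξ : Rd d) (y : Rd d) : ℂ :=
  Complex.exp (Complex.I * ((inner ℝ y ξ : ℝ) : ℂ))

theorem hasTemperateGrowth_exp_I :
    Function.HasTemperateGrowth (fun t : ℝ => Complex.exp (Complex.I * (t : ℂ))) := by
  refine ⟨?_, fun n => ⟨0, 1, fun t => ?_⟩⟩
  · exact Complex.contDiff_exp.comp (contDiff_const.mul Complex.ofRealCLM.contDiff)
  · have key : ∀ n : ℕ, iteratedDeriv n (fun t : ℝ => Complex.exp (Complex.I * (t : ℂ))) =
        fun t : ℝ => Complex.I ^ n * Complex.exp (Complex.I * (t : ℂ)) := by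
      intro n
      induction n with
      | zero => simp
      | succ n ih =>
        rw [iteratedDeriv_succ, ih]
        funext t
        have h1 : HasDerivAt (fun t : ℝ => Complex.I * (t : ℂ)) (Complex.I * 1) t :=
          (Complex.ofRealCLM.hasDerivAt (x := t)).const_mul Complex.I
        have h2 := (h1.cexp).const_mul (Complex.I ^ n)
        rw [h2.deriv]
        ring
    rw [norm_iteratedFDeriv_eq_norm_iteratedDeriv, key n]
    simp [Complex.norm_exp]

theorem hasTemperateGrowth_character {d : ℕ} (ξ : Rd d) :
    (character ξ).HasTemperateGrowth :=
  hasTemperateGrowth_exp_I.comp (Function.hasTemperateGrowth_inner_left ξ)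

/-- The time-frequency shift `Π(z) = M_ξ T_x`, `z = (x, ξ)`, on Schwartz functions. -/
def timeFreqShift {d : ℕ} (z : PhaseSpace d) : 𝓢(Rd d, ℂ) →L[ℂ] 𝓢(Rd d, ℂ) :=
  SchwartzMap.smulLeftCLM ℂ (character z.2) ∘L SchwartzMap.compSubConstCLM ℂ z.1

theorem timeFreqShift_apply {d : ℕ} (z : PhaseSpace d) (ψ : 𝓢(Rd d, ℂ)) (y : Rd d) :
    timeFreqShift z ψ y =
      Complex.exp (Complex.I * ((inner ℝ y z.2 : ℝ) : ℂ)) * ψ (y - z.1) := by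
  simp [timeFreqShift, hasTemperateGrowth_character, character]

/-- The complex conjugate of a Schwartz function. -/
def schwartzConj {d : ℕ} (ψ : 𝓢(Rd d, ℂ)) : 𝓢(Rd d, ℂ) :=
  SchwartzMap.postcompCLM (𝕜 := ℝ) (Complex.conjCLE : ℂ →L[ℝ] ℂ) ψ

theorem schwartzConj_apply {d : ℕ} (ψ : 𝓢(Rd d, ℂ)) (y : Rd d) :
    schwartzConj ψ y = (starRingEnd ℂ) (ψ y) := by
  simp [schwartzConj]

/-- The action `(u, ψ)` of a tempered distribution on a Schwartz function that is conjugate linear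
in `ψ` and extends the `L²` inner product, i.e. `(u, ψ) = ⟨u, ψ̄⟩`. -/
def sesqPairing {d : ℕ} (u : 𝓢'(Rd d, ℂ)) (ψ : 𝓢(Rd d, ℂ)) : ℂ := u (schwartzConj ψ)

/-- The short-time Fourier transform `V_ψ u(z) = (u, Π(z) ψ)`. -/
def stft {d : ℕ} (ψ : 𝓢(Rd d, ℂ)) (u : 𝓢'(Rd d, ℂ)) (z : PhaseSpace d) : ℂ :=
  sesqPairing u (timeFreqShift z ψ)

/-- The Gabor wave front set of `u`, computed with the window `φ`: the point `z₀ ≠ 0` is *not* in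
`WF_G(u)` if `V_φ u` decays rapidly in an open conic set `Γ ⊆ T^*ℝ^d ∖ 0` containing `z₀`. -/
def gaborWaveFrontSet {d : ℕ} (φ : 𝓢(Rd d, ℂ)) (u : 𝓢'(Rd d, ℂ)) : Set (PhaseSpace d) :=
  {z₀ | z₀ ≠ 0 ∧ ¬ ∃ Γ : Set (PhaseSpace d), IsOpenCone Γ ∧ z₀ ∈ Γ ∧
    ∀ N : ℕ, ∃ C : ℝ, ∀ z ∈ Γ, bracket₂ z ^ N * ‖stft φ u z‖ ≤ C}

/-- The classical `C^∞` wave front set of `u`: the point `(x₀, ξ₀)`, `ξ₀ ≠ 0`, is *not* in `WF(u)`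
if for some `φ ∈ C_c^∞(ℝ^d)` with `φ(0) ≠ 0` the function `ξ ↦ V_φ u(x₀, ξ)`, which is the Fourier
transform of the localization `u · conj φ(· - x₀)`, decays rapidly in an open conic set
`Γ₂ ⊆ ℝ^d ∖ 0` containing `ξ₀`. -/
def waveFrontSet {d : ℕ} (u : 𝓢'(Rd d, ℂ)) : Set (PhaseSpace d) :=
  {p | p.2 ≠ 0 ∧ ¬ ∃ (φ : 𝓢(Rd d, ℂ)) (Γ₂ : Set (Rd d)), HasCompactSupport φ ∧ φ 0 ≠ 0 ∧
    IsOpenCone Γ₂ ∧ p.2 ∈ Γ₂ ∧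
    ∀ N : ℕ, ∃ C : ℝ, ∀ ξ ∈ Γ₂, bracket ξ ^ N * ‖stft φ u (p.1, ξ)‖ ≤ C}

/-- `𝓔'(ℝ^d)`: the distributions with compact support, as a subset of `𝓢'(ℝ^d)`. -/
def compactlySupported (d : ℕ) : Set (𝓢'(Rd d, ℂ)) :=
  {v | IsCompact (Distribution.dsupport v)}

/-- `𝓢(ℝ^d)`, embedded in `𝓢'(ℝ^d)` by integration. -/
def schwartzFunctions (d : ℕ) : Set (𝓢'(Rd d, ℂ)) :=
  Set.range (SchwartzMap.toTemperedDistributionCLM (Rd d) ℂ MeasureTheory.volume)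

end GaborWF

end

/-! Testing against the modulated window, `u` splits as `u F = u (χ F) + ∫ f F` with `χ` a compactly
supported smooth function and `f` Schwartz (`exists_cutoff`). The transform of `f` decays rapidly on
all of phase space, so only the localized part `χ u` matters (`notMem_gaborWaveFrontSet`).

Position: `χ` times the window translated by `x` tends to zero rapidly in every Schwartz seminorm,
while `u` has finite order. Hence the transform of `χ u` is of size `(1 + |x|)^(-M) (1 + |ξ|)^k` for
every `M`, with `k` independent of `M`. In a cone `|ξ| < R |x|` the loss in `ξ` is absorbed, which
forces `x = 0` on the Gabor wave front set.

Frequency: if no `(x, ξ₀)` lies in `WF(u)`, each `x` has a window `a x`, nonzero at `x`, such that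
the Fourier transform of `a x · u` decays in a cone around `ξ₀`. By compactness `χ = ∑ a x · g x`
over finitely many `x` (`exists_eq_sum_mulSchwartz`). Multiplying by `g x` and the moving window
convolves on the Fourier side with a kernel that decays rapidly, uniformly in the translation, so
decay persists in a slightly smaller cone (`exists_bound_localized`). The finitely many cones
intersect in a cone around `ξ₀`.

That convolution formula needs a distribution to commute with an integral (`map_convSchwartz`). For
this the functional is factored, by Hahn–Banach, through a Banach space of weighted derivatives,
where Bochner integration applies. -/

noncomputable section

namespace GaborWF

open SchwartzMap FourierTransform LineDeriv MeasureTheory Filter Topology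
open scoped BoundedContinuousFunction ContDiff

/-! ### Translations in Schwartz space; factoring functionals through Banach spaces -/

section Superposition

variable {E : Type*} [NormedAddCommGroup E] [NormedSpace ℝ E]

theorem iteratedFDeriv_compSubConst (f : 𝓢(E, ℂ)) (n : ℕ) (a y : E) :
    iteratedFDeriv ℝ n (compSubConstCLM ℂ a f) y = iteratedFDeriv ℝ n f (y - a) :=
  iteratedFDeriv_comp_sub n a y

/-- Mean value inequality on the segment from `y` to `y - a`, with the weight frozen at `y`. Since
`‖a‖ ≤ 1`, the frozen weight is at most `(‖z‖ + 1) ^ k` at every `z` of the segment. -/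
theorem seminorm_compSubConst_sub_le (f : 𝓢(E, ℂ)) (k n : ℕ) {a : E} (ha : ‖a‖ ≤ 1) :
    SchwartzMap.seminorm ℂ k n (compSubConstCLM ℂ a f - f) ≤
      ‖a‖ * (2 ^ k * (SchwartzMap.seminorm ℂ k (n + 1) f + SchwartzMap.seminorm ℂ 0 (n + 1) f)) := by
  refine seminorm_le_bound ℂ k n _ (by positivity) fun y => ?_
  have hcoe : iteratedFDeriv ℝ n (compSubConstCLM ℂ a f - f) y =
      iteratedFDeriv ℝ n f (y - a) - iteratedFDeriv ℝ n f y := by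
    rw [← iteratedFDeriv_compSubConst]
    exact iteratedFDeriv_sub_apply ((smooth _ ⊤).contDiffAt.of_le (mod_cast le_top))
      ((smooth _ ⊤).contDiffAt.of_le (mod_cast le_top))
  rw [hcoe]
  have hd : Differentiable ℝ (iteratedFDeriv ℝ n f) :=
    (f.smooth ⊤).differentiable_iteratedFDeriv (mod_cast WithTop.coe_lt_top _)
  have key := (convex_segment (𝕜 := ℝ) y (y - a)).norm_image_sub_le_of_norm_fderiv_le (𝕜 := ℝ)
    (f := fun z => ‖y‖ ^ k • iteratedFDeriv ℝ n f z)
    (C := 2 ^ k * (SchwartzMap.seminorm ℂ k (n + 1) f + SchwartzMap.seminorm ℂ 0 (n + 1) f))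
    (fun z _ => (hd z).fun_const_smul _) (fun z hz => ?_) (left_mem_segment ℝ _ _)
    (right_mem_segment ℝ _ _)
  · rw [← smul_sub, norm_smul, norm_pow, norm_norm] at key
    refine key.trans (le_of_eq ?_)
    rw [show y - a - y = -a by abel, norm_neg, mul_comm]
  · rw [fderiv_fun_const_smul (hd z), norm_smul, norm_pow, norm_norm,
      norm_fderiv_iteratedFDeriv]
    have hyz : ‖y‖ ≤ ‖z‖ + 1 := by
      have h1 : ‖y - z‖ ≤ ‖a‖ := by
        rw [segment_eq_image'] at hz
        obtain ⟨t, ⟨ht0, ht1⟩, rfl⟩ := hz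
        rw [show y - (y + t • (y - a - y)) = t • a by module, norm_smul, Real.norm_of_nonneg ht0]
        exact mul_le_of_le_one_left (norm_nonneg _) ht1
      have h2 := norm_add_le (y - z) z
      rw [sub_add_cancel] at h2
      linarith
    have hpow : ‖y‖ ^ k ≤ 2 ^ k * (‖z‖ ^ k + 1) := by
      refine (pow_le_pow_left₀ (norm_nonneg _) hyz k).trans ?_
      refine (add_pow_le (norm_nonneg _) zero_le_one k).trans ?_
      rw [one_pow]
      gcongr
      · norm_num
      · omega
    refine (mul_le_mul_of_nonneg_right hpow (norm_nonneg _)).trans ?_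
    rw [mul_assoc, add_mul, one_mul]
    gcongr
    · exact le_seminorm ℂ _ _ _ _
    · exact norm_iteratedFDeriv_le_seminorm ℂ _ _ _

theorem seminorm_compSubConst_le (f : 𝓢(E, ℂ)) (k n : ℕ) (a : E) :
    SchwartzMap.seminorm ℂ k n (compSubConstCLM ℂ a f) ≤
      2 ^ k * (SchwartzMap.seminorm ℂ k n f + SchwartzMap.seminorm ℂ 0 n f) * (1 + ‖a‖ ^ k) := by
  refine seminorm_le_bound ℂ k n _ (by positivity) fun y => ?_
  rw [iteratedFDeriv_compSubConst]
  have hpow : ‖y‖ ^ k ≤ 2 ^ k * (‖y - a‖ ^ k + ‖a‖ ^ k) := by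
    have h2 := norm_add_le (y - a) a
    rw [sub_add_cancel] at h2
    refine (pow_le_pow_left₀ (norm_nonneg _) h2 k).trans ?_
    refine (add_pow_le (norm_nonneg _) (norm_nonneg _) k).trans ?_
    gcongr
    · norm_num
    · omega
  have h1 := le_seminorm ℂ k n f (y - a)
  have h2 := norm_iteratedFDeriv_le_seminorm ℂ f n (y - a)
  calc ‖y‖ ^ k * ‖iteratedFDeriv ℝ n f (y - a)‖
      ≤ 2 ^ k * (‖y - a‖ ^ k + ‖a‖ ^ k) * ‖iteratedFDeriv ℝ n f (y - a)‖ := by gcongr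
    _ = 2 ^ k * (‖y - a‖ ^ k * ‖iteratedFDeriv ℝ n f (y - a)‖ +
        ‖a‖ ^ k * ‖iteratedFDeriv ℝ n f (y - a)‖) := by ring
    _ ≤ 2 ^ k * (SchwartzMap.seminorm ℂ k n f + ‖a‖ ^ k * SchwartzMap.seminorm ℂ 0 n f) := by
      gcongr
    _ ≤ _ := by
      have h3 : 0 ≤ SchwartzMap.seminorm ℂ k n f := apply_nonneg _ _
      have h4 : 0 ≤ SchwartzMap.seminorm ℂ 0 n f := apply_nonneg _ _
      have h5 : 0 ≤ ‖a‖ ^ k := by positivity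
      rw [mul_assoc]
      gcongr
      nlinarith [mul_nonneg h3 h5]

theorem continuous_compSubConst (f : 𝓢(E, ℂ)) :
    Continuous fun a : E => compSubConstCLM ℂ a f := by
  have h0 : Tendsto (fun a : E => compSubConstCLM ℂ a f) (𝓝 0) (𝓝 f) := by
    rw [(schwartz_withSeminorms ℂ E ℂ).tendsto_nhds]
    intro i ε hε
    change ∀ᶠ a in 𝓝 0, SchwartzMap.seminorm ℂ i.1 i.2 (compSubConstCLM ℂ a f - f) < ε
    generalize i.1 = k
    generalize i.2 = n
    set A := 2 ^ k * (SchwartzMap.seminorm ℂ k (n + 1) f + SchwartzMap.seminorm ℂ 0 (n + 1) f)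
    have hA : Tendsto (fun a : E => ‖a‖ * A) (𝓝 0) (𝓝 0) := by
      have := (continuous_norm (E := E)).tendsto 0
      simpa using this.mul_const A
    filter_upwards [hA.eventually (gt_mem_nhds hε), Metric.closedBall_mem_nhds (0 : E) one_pos]
      with a h1 h2
    exact (seminorm_compSubConst_sub_le f k n (by simpa using h2)).trans_lt h1
  -- By the group law, translation by `b` is translation by `b - a` followed by the continuous map
  -- of translation by `a`.
  rw [continuous_iff_continuousAt]
  intro a
  have h1 : Tendsto (fun b : E => b - a) (𝓝 a) (𝓝 0) := by
    have : ContinuousAt (fun b : E => b - a) a := by fun_prop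
    simpa [ContinuousAt] using this
  have h2 := ((compSubConstCLM ℂ a).continuous.tendsto f).comp (h0.comp h1)
  refine h2.congr fun b => ?_
  simp

/-- Bounded continuous functions with values in the `n`-multilinear forms, where the latter carry
the metric of their operator norm. -/
def BoundedForms (E : Type*) [NormedAddCommGroup E] [NormedSpace ℝ E] (n : ℕ) : Type _ :=
  @BoundedContinuousFunction E (E [×n]→L[ℝ] ℂ) _ SeminormedAddCommGroup.toPseudoMetricSpace

namespace BoundedForms

instance (n : ℕ) : NormedAddCommGroup (BoundedForms E n) :=
  inferInstanceAs (NormedAddCommGroup (@BoundedContinuousFunction E (E [×n]→L[ℝ] ℂ) _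
    SeminormedAddCommGroup.toPseudoMetricSpace))

instance (n : ℕ) : NormedSpace ℂ (BoundedForms E n) :=
  inferInstanceAs (NormedSpace ℂ (@BoundedContinuousFunction E (E [×n]→L[ℝ] ℂ) _
    SeminormedAddCommGroup.toPseudoMetricSpace))

instance (n : ℕ) : CompleteSpace (BoundedForms E n) :=
  inferInstanceAs (CompleteSpace (@BoundedContinuousFunction E (E [×n]→L[ℝ] ℂ) _
    SeminormedAddCommGroup.toPseudoMetricSpace))

/-- The value at `y` of a bounded continuous function, as a continuous linear map. -/
def eval (n : ℕ) (y : E) : BoundedForms E n →L[ℂ] (E [×n]→L[ℝ] ℂ) :=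
  BoundedContinuousFunction.evalCLM ℂ y

theorem ext_eval {n : ℕ} {b c : BoundedForms E n} (h : ∀ y m, eval n y b m = eval n y c m) :
    b = c :=
  BoundedContinuousFunction.ext fun y => ContinuousMultilinearMap.ext (h y)

theorem norm_eval_le {n : ℕ} (b : BoundedForms E n) (y : E) : ‖eval n y b‖ ≤ ‖b‖ :=
  BoundedContinuousFunction.norm_coe_le_norm _ y

end BoundedForms

/-- The weighted derivative `y ↦ ‖y‖ ^ k • D ^ n f(y)` of a Schwartz function, as a bounded
continuous function. -/
def weightedDerivFun (k n : ℕ) (f : 𝓢(E, ℂ)) : BoundedForms E n :=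
  BoundedContinuousFunction.ofNormedAddCommGroup
    (fun y => ‖y‖ ^ k • iteratedFDeriv ℝ n f y)
    ((continuous_norm.pow k).smul ((f.smooth ⊤).continuous_iteratedFDeriv (mod_cast le_top)))
    (SchwartzMap.seminorm ℂ k n f)
    (fun y => by rw [norm_smul, norm_pow, norm_norm]; exact le_seminorm ℂ k n f y)

theorem norm_weightedDerivFun_le (k n : ℕ) (f : 𝓢(E, ℂ)) :
    ‖weightedDerivFun k n f‖ ≤ SchwartzMap.seminorm ℂ k n f :=
  BoundedContinuousFunction.norm_ofNormedAddCommGroup_le _ (apply_nonneg _ _) _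

theorem eval_weightedDerivFun (k n : ℕ) (f : 𝓢(E, ℂ)) (y : E) :
    BoundedForms.eval n y (weightedDerivFun k n f) = ‖y‖ ^ k • iteratedFDeriv ℝ n f y := rfl

/-- `weightedDerivFun` as a continuous linear map. -/
def weightedDeriv (k n : ℕ) : 𝓢(E, ℂ) →L[ℂ] BoundedForms E n :=
  mkCLMtoNormedSpace (D := E) (E := ℂ) (σ := RingHom.id ℂ) (weightedDerivFun k n)
    (fun f g => by
      refine BoundedForms.ext_eval fun y m => ?_
      have : iteratedFDeriv ℝ n (f + g : 𝓢(E, ℂ)) y =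
          iteratedFDeriv ℝ n f y + iteratedFDeriv ℝ n g y :=
        iteratedFDeriv_add_apply ((smooth _ ⊤).contDiffAt.of_le (mod_cast le_top))
          ((smooth _ ⊤).contDiffAt.of_le (mod_cast le_top))
      rw [map_add, eval_weightedDerivFun, eval_weightedDerivFun, eval_weightedDerivFun, this,
        smul_add])
    (fun c f => by
      refine BoundedForms.ext_eval fun y m => ?_
      have : iteratedFDeriv ℝ n (c • f : 𝓢(E, ℂ)) y = c • iteratedFDeriv ℝ n f y :=
        iteratedFDeriv_const_smul_apply ((smooth _ ⊤).contDiffAt.of_le (mod_cast le_top))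
      rw [map_smulₛₗ, eval_weightedDerivFun, eval_weightedDerivFun, this, smul_comm]
      rfl)
    ⟨{(k, n)}, 1, zero_le_one, fun f => by
      rw [one_mul, Finset.sup_singleton]
      exact norm_weightedDerivFun_le k n f⟩

theorem norm_weightedDeriv_le (k n : ℕ) (f : 𝓢(E, ℂ)) :
    ‖weightedDeriv k n f‖ ≤ SchwartzMap.seminorm ℂ k n f :=
  norm_weightedDerivFun_le k n f

theorem eval_weightedDeriv (k n : ℕ) (f : 𝓢(E, ℂ)) (y : E) :
    BoundedForms.eval n y (weightedDeriv k n f) = ‖y‖ ^ k • iteratedFDeriv ℝ n f y := rfl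

theorem seminorm_le_norm_weightedDeriv (k n : ℕ) (f : 𝓢(E, ℂ)) :
    SchwartzMap.seminorm ℂ k n f ≤ ‖weightedDeriv k n f‖ := by
  refine seminorm_le_bound ℂ k n _ (norm_nonneg _) fun y => ?_
  have := BoundedForms.norm_eval_le (weightedDeriv k n f) y
  rwa [eval_weightedDeriv, norm_smul, norm_pow, norm_norm] at this

/-- The finitely many weighted derivatives of a Schwartz function that are indexed by `s`. -/
def weightedDerivs (s : Finset (ℕ × ℕ)) :
    𝓢(E, ℂ) →L[ℂ] ((i : s) → BoundedForms E i.1.2) :=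
  ContinuousLinearMap.pi fun i => weightedDeriv i.1.1 i.1.2

theorem sup_seminorm_le_norm_weightedDerivs (s : Finset (ℕ × ℕ)) (f : 𝓢(E, ℂ)) :
    s.sup (schwartzSeminormFamily ℂ E ℂ) f ≤ ‖weightedDerivs s f‖ := by
  refine Seminorm.finset_sup_apply_le (norm_nonneg _) fun i hi => ?_
  refine (seminorm_le_norm_weightedDeriv i.1 i.2 f).trans ?_
  exact norm_le_pi_norm (weightedDerivs s f) ⟨i, hi⟩

/-- A functional on a vector space that is dominated by the norm of a linear map into a normed
space factors through that map. -/
theorem exists_eq_comp_of_norm_le {V B : Type*} [AddCommGroup V] [Module ℂ V]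
    [NormedAddCommGroup B] [NormedSpace ℂ B] (L : V →ₗ[ℂ] ℂ) (T : V →ₗ[ℂ] B) (C : ℝ)
    (h : ∀ f, ‖L f‖ ≤ C * ‖T f‖) : ∃ ℓ : B →L[ℂ] ℂ, ∀ f, L f = ℓ (T f) := by
  -- A merely linear section is enough: the bound on `L` sees only `T (g b) = b`.
  obtain ⟨g, hg⟩ := T.rangeRestrict.exists_rightInverse_of_surjective
    (LinearMap.range_rangeRestrict T)
  have hg' : ∀ b : LinearMap.range T, T (g b) = b := fun b => by
    have := LinearMap.congr_fun hg b
    exact congrArg Subtype.val this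
  obtain ⟨ℓ, hℓ⟩ := StrongDual.exists_extension (LinearMap.range T)
    ((L ∘ₗ g).mkContinuous C fun b => by simpa [hg'] using h (g b))
  refine ⟨ℓ, fun f => ?_⟩
  have h1 := hℓ ⟨T f, f, rfl⟩
  -- The argument lies in the kernel of `T`, on which the bound makes `L` vanish.
  have h2 := h (f - g ⟨T f, f, rfl⟩)
  rw [map_sub, map_sub, hg', sub_self, norm_zero, mul_zero, norm_le_zero_iff, sub_eq_zero] at h2
  rw [h2]
  exact h1.symm

theorem exists_norm_le_sup_seminorm (L : 𝓢(E, ℂ) →L[ℂ] ℂ) :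
    ∃ (s : Finset (ℕ × ℕ)) (C : ℝ), ∀ f,
      ‖L f‖ ≤ C * s.sup (schwartzSeminormFamily ℂ E ℂ) f := by
  obtain ⟨s, C, -, h⟩ := Seminorm.bound_of_continuous (schwartz_withSeminorms ℂ E ℂ)
    ((normSeminorm ℂ ℂ).comp L.toLinearMap) (continuous_norm.comp L.continuous)
  exact ⟨s, C, fun f => h f⟩

theorem exists_eq_comp_weightedDerivs (L : 𝓢(E, ℂ) →L[ℂ] ℂ) :
    ∃ (s : Finset (ℕ × ℕ)) (ℓ : ((i : s) → BoundedForms E i.1.2) →L[ℂ] ℂ),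
      ∀ f, L f = ℓ (weightedDerivs s f) := by
  obtain ⟨s, C, h⟩ := exists_norm_le_sup_seminorm L
  have hC : ∀ f, ‖L f‖ ≤ |C| * ‖weightedDerivs s f‖ := fun f =>
    (h f).trans (mul_le_mul (le_abs_self C) (sup_seminorm_le_norm_weightedDerivs s f)
      (apply_nonneg _ _) (abs_nonneg _))
  obtain ⟨ℓ, hℓ⟩ :=
    exists_eq_comp_of_norm_le (B := (i : s) → BoundedForms E i.1.2) L.toLinearMap
      (weightedDerivs s).toLinearMap |C| hC
  exact ⟨s, ℓ, hℓ⟩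

end Superposition

/-! ### Interchanging a distribution with a convolution integral -/

section Superposition

variable {E : Type*} [NormedAddCommGroup E] [InnerProductSpace ℝ E] [FiniteDimensional ℝ E]
  [MeasurableSpace E] [BorelSpace E]

/-- The pointwise product of Schwartz functions. -/
abbrev mulSchwartz {E : Type*} [NormedAddCommGroup E] [NormedSpace ℝ E] :
    𝓢(E, ℂ) →ₗ[ℂ] 𝓢(E, ℂ) →L[ℂ] 𝓢(E, ℂ) :=
  pairing (ContinuousLinearMap.mul ℂ ℂ)

/-- The convolution product of Schwartz functions. -/
abbrev convSchwartz : 𝓢(E, ℂ) →ₗ[ℂ] 𝓢(E, ℂ) →L[ℂ] 𝓢(E, ℂ) :=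
  convolution (ContinuousLinearMap.mul ℂ ℂ)

/-- On the Fourier side the derivative is multiplication by a scalar function, which can be attached
to either factor of the product. -/
theorem lineDerivOp_convSchwartz (g ψ : 𝓢(E, ℂ)) (m : E) :
    ∂_{m} (convSchwartz g ψ) = convSchwartz g (∂_{m} ψ) := by
  have h : (inner ℝ · m : E → ℝ).HasTemperateGrowth := by fun_prop
  change ∂_{m} (𝓕⁻ (mulSchwartz (𝓕 g) (𝓕 ψ))) = 𝓕⁻ (mulSchwartz (𝓕 g) (𝓕 (∂_{m} ψ)))
  rw [lineDerivOp_fourierInv_eq, fourier_lineDerivOp_eq]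
  congr 1
  ext y
  simp [h]
  ring

theorem iteratedLineDerivOp_convSchwartz (g ψ : 𝓢(E, ℂ)) {n : ℕ} (m : Fin n → E) :
    ∂^{m} (convSchwartz g ψ) = convSchwartz g (∂^{m} ψ) := by
  induction n with
  | zero => simp
  | succ n ih =>
    rw [iteratedLineDerivOp_succ_left, ih, lineDerivOp_convSchwartz,
      iteratedLineDerivOp_succ_left]

theorem convSchwartz_apply (g ψ : 𝓢(E, ℂ)) (y : E) :
    convSchwartz g ψ y = ∫ a, g a * ψ (y - a) := by
  rw [convolution_apply, convolution_def]
  rfl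

theorem integrable_smul_of_seminorm_le {B : Type*} [NormedAddCommGroup B] [NormedSpace ℂ B]
    (g : 𝓢(E, ℂ)) {T : E → B} (hT : Continuous T) {C : ℝ} {k : ℕ}
    (h : ∀ a, ‖T a‖ ≤ C * (1 + ‖a‖ ^ k)) : Integrable fun a => g a • T a := by
  have h1 : Integrable fun a => C * (‖a‖ ^ 0 * ‖g a‖ + ‖a‖ ^ k * ‖g a‖) :=
    ((g.integrable_pow_mul volume 0).add (g.integrable_pow_mul volume k)).const_mul C
  refine h1.mono' (g.continuous.smul hT).aestronglyMeasurable (.of_forall fun a => ?_)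
  rw [norm_smul]
  refine (mul_le_mul_of_nonneg_left (h a) (norm_nonneg _)).trans (le_of_eq ?_)
  ring

theorem integrable_smul_weightedDeriv (g ψ : 𝓢(E, ℂ)) (k n : ℕ) :
    Integrable fun a => g a • weightedDeriv k n (compSubConstCLM ℂ a ψ) :=
  integrable_smul_of_seminorm_le g ((weightedDeriv k n).continuous.comp
    (continuous_compSubConst ψ)) fun a =>
      (norm_weightedDeriv_le k n _).trans (seminorm_compSubConst_le ψ k n a)

/-- An equality of Banach-space elements, tested at a point and on vectors; evaluation passes
through the Bochner integral, and there the derivatives of the convolution all fall on `ψ`. -/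
theorem weightedDeriv_convSchwartz (g ψ : 𝓢(E, ℂ)) (k n : ℕ) :
    weightedDeriv k n (convSchwartz g ψ) =
      ∫ a, g a • weightedDeriv k n (compSubConstCLM ℂ a ψ) := by
  refine BoundedForms.ext_eval fun y m => ?_
  rw [← (BoundedForms.eval n y).integral_comp_comm (integrable_smul_weightedDeriv g ψ k n)]
  have hint := (BoundedForms.eval n y).integrable_comp (integrable_smul_weightedDeriv g ψ k n)
  have h1 := (ContinuousMultilinearMap.apply ℝ (fun _ : Fin n => E) ℂ m).integral_comp_comm hint
  refine Eq.trans ?_ h1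
  simp only [ContinuousMultilinearMap.apply_apply, map_smul, eval_weightedDeriv,
    _root_.smul_apply, iteratedFDeriv_compSubConst]
  simp only [← iteratedLineDerivOp_eq_iteratedFDeriv, iteratedLineDerivOp_convSchwartz,
    convSchwartz_apply]
  rw [← integral_smul]
  refine integral_congr_ae (.of_forall fun a => ?_)
  simp [mul_left_comm]

/-- A tempered distribution may be interchanged with the integral defining a convolution. -/
theorem map_convSchwartz (L : 𝓢(E, ℂ) →L[ℂ] ℂ) (g ψ : 𝓢(E, ℂ)) :
    L (convSchwartz g ψ) = ∫ a, g a * L (compSubConstCLM ℂ a ψ) := by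
  obtain ⟨s, ℓ, hℓ⟩ := exists_eq_comp_weightedDerivs L
  have hint : Integrable fun a => g a • weightedDerivs s (compSubConstCLM ℂ a ψ) :=
    Integrable.of_eval fun i => integrable_smul_weightedDeriv g ψ i.1.1 i.1.2
  have h1 : weightedDerivs s (convSchwartz g ψ) =
      ∫ a, g a • weightedDerivs s (compSubConstCLM ℂ a ψ) := by
    funext i
    exact (weightedDeriv_convSchwartz g ψ i.1.1 i.1.2).trans
      (eval_integral (fun i : s => integrable_smul_weightedDeriv g ψ i.1.1 i.1.2) i).symm
  rw [hℓ, h1, ← ℓ.integral_comp_comm hint]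
  simp [hℓ]

end Superposition

/-! ### Modulations and quantitative decay -/

section Bounds

variable {d : ℕ}

/-- Modulation `f ↦ e^{i⟨·, ξ⟩} f`. -/
abbrev modulate (ξ : Rd d) : 𝓢(Rd d, ℂ) →L[ℂ] 𝓢(Rd d, ℂ) :=
  smulLeftCLM ℂ (character ξ)

theorem modulate_apply (ξ : Rd d) (f : 𝓢(Rd d, ℂ)) (y : Rd d) :
    modulate ξ f y = character ξ y * f y := by
  simp [hasTemperateGrowth_character]

theorem character_add (ξ η y : Rd d) :
    character (ξ + η) y = character ξ y * character η y := by
  simp only [character]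
  rw [← Complex.exp_add, inner_add_right]
  push_cast
  ring_nf

theorem modulate_modulate (ξ η : Rd d) (f : 𝓢(Rd d, ℂ)) :
    modulate ξ (modulate η f) = modulate (ξ + η) f := by
  ext y
  rw [modulate_apply, modulate_apply, modulate_apply, character_add, mul_assoc]

theorem mulSchwartz_modulate (ξ : Rd d) (f g : 𝓢(Rd d, ℂ)) :
    mulSchwartz f (modulate ξ g) = modulate ξ (mulSchwartz f g) := by
  ext y
  simp only [modulate_apply, pairing_apply_apply, ContinuousLinearMap.mul_apply']
  ring

/-- The factor `-2π` reconciles the kernel `e^{-2πi⟨v, w⟩}` of `𝓕` with `character`, which carries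
no `2π`. -/
theorem fourier_compSubConst (a : Rd d) (f : 𝓢(Rd d, ℂ)) :
    𝓕 (compSubConstCLM ℂ a f) = modulate (-(2 * Real.pi) • a) (𝓕 f) := by
  ext w
  rw [modulate_apply, fourier_coe, fourier_coe, Real.fourier_eq', Real.fourier_eq',
    ← integral_const_mul, ← integral_add_right_eq_self _ a]
  refine integral_congr_ae (.of_forall fun v => ?_)
  simp only [compSubConstCLM_apply, add_sub_cancel_right, smul_eq_mul, character]
  rw [← mul_assoc, ← Complex.exp_add, inner_add_left, inner_smul_right, real_inner_comm a w]
  push_cast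
  ring_nf

theorem modulate_eq_fourier (ξ : Rd d) (f : 𝓢(Rd d, ℂ)) :
    modulate ξ f = 𝓕 (compSubConstCLM ℂ (-(2 * Real.pi)⁻¹ • ξ) (𝓕⁻ f)) := by
  rw [fourier_compSubConst, FourierTransform.fourier_fourierInv_eq, smul_smul]
  congr 1
  have : -(2 * Real.pi) * -(2 * Real.pi)⁻¹ = 1 := by
    field_simp
  rw [this, one_smul]

/-- The value of a tempered distribution on a product, expressed by Fourier inversion of one of
the factors. -/
theorem map_mulSchwartz (L : 𝓢(Rd d, ℂ) →L[ℂ] ℂ) (f g : 𝓢(Rd d, ℂ)) :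
    L (mulSchwartz f g) = ∫ ζ, 𝓕⁻ g ζ * L (modulate (-(2 * Real.pi) • ζ) f) := by
  -- Under `𝓕` the convolution becomes the product and the translates of `𝓕⁻ f` become modulations
  -- of `f`.
  have h := map_convSchwartz (L ∘L fourierCLM ℂ 𝓢(Rd d, ℂ)) (𝓕⁻ g) (𝓕⁻ f)
  simp only [ContinuousLinearMap.comp_apply, fourierCLM_apply, fourier_compSubConst,
    FourierTransform.fourier_fourierInv_eq, fourier_convolution] at h
  rw [← h]
  congr 1
  ext y
  simp [mul_comm]

theorem one_add_norm_add_le (x y : Rd d) : 1 + ‖x + y‖ ≤ (1 + ‖x‖) * (1 + ‖y‖) := by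
  nlinarith [norm_add_le x y, norm_nonneg x, norm_nonneg y]

theorem seminorm_sum_apply {ι V : Type*} [AddCommGroup V] [Module ℂ V]
    (p : ι → Seminorm ℂ V) (s : Finset ι) (f : V) : (∑ i ∈ s, p i) f = ∑ i ∈ s, p i f := by
  induction s using Finset.cons_induction with
  | empty => rfl
  | cons i s hi ih => rw [Finset.sum_cons, Finset.sum_cons, _root_.add_apply, ih]

/-- A continuous seminorm is dominated by a multiple of a finite sum of the standard ones. -/
theorem exists_seminorm_le_sum (q : Seminorm ℂ 𝓢(Rd d, ℂ)) (hq : Continuous q) :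
    ∃ (s : Finset (ℕ × ℕ)) (C : ℝ), 0 ≤ C ∧ ∀ f, q f ≤ C * ∑ i ∈ s, SchwartzMap.seminorm ℂ i.1 i.2 f := by
  obtain ⟨s, C, -, h⟩ := Seminorm.bound_of_continuous (schwartz_withSeminorms ℂ (Rd d) ℂ) q hq
  refine ⟨s, C, C.2, fun f => (h f).trans ?_⟩
  refine mul_le_mul_of_nonneg_left ?_ C.2
  refine (Seminorm.finset_sup_le_sum _ s f).trans (le_of_eq ?_)
  rw [seminorm_sum_apply]
  rfl

theorem continuous_seminorm (k n : ℕ) : Continuous (SchwartzMap.seminorm ℂ k n : Seminorm ℂ 𝓢(Rd d, ℂ)) :=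
  (schwartz_withSeminorms ℂ (Rd d) ℂ).continuous_seminorm (k, n)

/-- Boundedness in all weighted standard seminorms implies boundedness in all weighted continuous
seminorms. -/
theorem exists_bound_of_forall_seminorm {ι : Type*} (f : ι → 𝓢(Rd d, ℂ)) (w : ι → ℝ)
    (h : ∀ k n, ∃ C, ∀ i, w i * SchwartzMap.seminorm ℂ k n (f i) ≤ C)
    (q : Seminorm ℂ 𝓢(Rd d, ℂ)) (hq : Continuous q) (hw : ∀ i, 0 ≤ w i) :
    ∃ C, ∀ i, w i * q (f i) ≤ C := by
  obtain ⟨s, C, hC, hs⟩ := exists_seminorm_le_sum q hq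
  choose A hA using h
  refine ⟨C * ∑ j ∈ s, A j.1 j.2, fun i => ?_⟩
  refine (mul_le_mul_of_nonneg_left (hs (f i)) (hw i)).trans ?_
  rw [mul_left_comm, Finset.mul_sum]
  exact mul_le_mul_of_nonneg_left (Finset.sum_le_sum fun j _ => hA j.1 j.2 i) hC

/-- Tempered distributions grow polynomially under modulation. -/
theorem exists_norm_map_modulate_le (L : 𝓢(Rd d, ℂ) →L[ℂ] ℂ) :
    ∃ (k : ℕ) (q : Seminorm ℂ 𝓢(Rd d, ℂ)), Continuous q ∧
      ∀ ξ f, ‖L (modulate ξ f)‖ ≤ (1 + ‖ξ‖) ^ k * q f := by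
  obtain ⟨s, C, hC, h⟩ := exists_seminorm_le_sum
    ((normSeminorm ℂ ℂ).comp (L ∘L fourierCLM ℂ 𝓢(Rd d, ℂ)).toLinearMap)
    (continuous_norm.comp (L ∘L fourierCLM ℂ 𝓢(Rd d, ℂ)).continuous)
  have h2 : ∀ f, ‖L (𝓕 f)‖ ≤ C * ∑ i ∈ s, SchwartzMap.seminorm ℂ i.1 i.2 f := h
  -- Modulation is translation on the Fourier side, so `2 ^ i.1` comes from
  -- `seminorm_compSubConst_le`; the other `2` comes from `hb`.
  let r : ℕ × ℕ → Seminorm ℂ 𝓢(Rd d, ℂ) := fun i =>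
    (2 ^ i.1 * 2 * ⟨C, hC⟩ : NNReal) • (SchwartzMap.seminorm ℂ i.1 i.2 + SchwartzMap.seminorm ℂ 0 i.2)
  have hr : ∀ i f, r i f = 2 ^ i.1 * 2 * C *
    (SchwartzMap.seminorm ℂ i.1 i.2 f + SchwartzMap.seminorm ℂ 0 i.2 f) := fun i f => rfl
  let q : Seminorm ℂ 𝓢(Rd d, ℂ) :=
    (∑ i ∈ s, r i).comp (fourierInvCLM ℂ 𝓢(Rd d, ℂ)).toLinearMap
  have hq : ∀ f, q f = ∑ i ∈ s, r i (𝓕⁻ f) := fun f => seminorm_sum_apply _ _ _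
  refine ⟨s.sup Prod.fst, q, ?_, fun ξ f => ?_⟩
  · have : (q : 𝓢(Rd d, ℂ) → ℝ) = fun f => ∑ i ∈ s, 2 ^ i.1 * 2 * C *
        (SchwartzMap.seminorm ℂ i.1 i.2 (fourierInvCLM ℂ 𝓢(Rd d, ℂ) f) +
          SchwartzMap.seminorm ℂ 0 i.2 (fourierInvCLM ℂ 𝓢(Rd d, ℂ) f)) := funext hq
    rw [this]
    refine continuous_finsetSum _ fun i _ => continuous_const.mul (.add ?_ ?_)
    · exact (continuous_seminorm i.1 i.2).comp (fourierInvCLM ℂ 𝓢(Rd d, ℂ)).continuous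
    · exact (continuous_seminorm 0 i.2).comp (fourierInvCLM ℂ 𝓢(Rd d, ℂ)).continuous
  · rw [modulate_eq_fourier, hq]
    refine (h2 _).trans ?_
    rw [Finset.mul_sum, Finset.mul_sum]
    refine Finset.sum_le_sum fun i hi => ?_
    rw [hr]
    refine (mul_le_mul_of_nonneg_left (seminorm_compSubConst_le _ _ _ _) hC).trans ?_
    set P := SchwartzMap.seminorm ℂ i.1 i.2 (𝓕⁻ f) + SchwartzMap.seminorm ℂ 0 i.2 (𝓕⁻ f)
    have hP : 0 ≤ P := add_nonneg (apply_nonneg _ _) (apply_nonneg _ _)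
    have ha : ‖-(2 * Real.pi)⁻¹ • ξ‖ ≤ ‖ξ‖ := by
      rw [norm_smul, norm_neg, norm_inv, Real.norm_of_nonneg (by positivity)]
      refine mul_le_of_le_one_left (norm_nonneg _) (inv_le_one_of_one_le₀ ?_)
      linarith [Real.pi_gt_three]
    have hb : 1 + ‖-(2 * Real.pi)⁻¹ • ξ‖ ^ i.1 ≤ 2 * (1 + ‖ξ‖) ^ s.sup Prod.fst := by
      have h3 : (1 + ‖ξ‖) ^ i.1 ≤ (1 + ‖ξ‖) ^ s.sup Prod.fst :=
        pow_le_pow_right₀ (by linarith [norm_nonneg ξ]) (Finset.le_sup (f := Prod.fst) hi)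
      have h4 : ‖-(2 * Real.pi)⁻¹ • ξ‖ ^ i.1 ≤ (1 + ‖ξ‖) ^ i.1 :=
        pow_le_pow_left₀ (norm_nonneg _) (by linarith) _
      have h5 : 1 ≤ (1 + ‖ξ‖) ^ s.sup Prod.fst := one_le_pow₀ (by linarith [norm_nonneg ξ])
      linarith
    calc C * (2 ^ i.1 * P * (1 + ‖-(2 * Real.pi)⁻¹ • ξ‖ ^ i.1))
        ≤ C * (2 ^ i.1 * P * (2 * (1 + ‖ξ‖) ^ s.sup Prod.fst)) := by gcongr
      _ = _ := by ring

/-- The products of a fixed Schwartz function with the translates of another one decay rapidly in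
the translation parameter, in all standard seminorms. -/
theorem exists_bound_seminorm_mulSchwartz_compSubConst (χ φ : 𝓢(Rd d, ℂ)) (M k n : ℕ) :
    ∃ C, ∀ x : Rd d,
      (1 + ‖x‖) ^ M * SchwartzMap.seminorm ℂ k n (mulSchwartz χ (compSubConstCLM ℂ x φ)) ≤ C := by
  let A : ℝ := 2 ^ (M + k) * (Finset.Iic (M + k, n)).sup
    (fun m => SchwartzMap.seminorm ℂ m.1 m.2) χ
  let B : ℝ := 2 ^ M * (Finset.Iic (M, n)).sup (fun m => SchwartzMap.seminorm ℂ m.1 m.2) φ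
  refine ⟨∑ i ∈ Finset.range (n + 1), (n.choose i : ℝ) * (A * B), fun x => ?_⟩
  have hx : 0 < (1 + ‖x‖) ^ M := by positivity
  rw [← le_div_iff₀' hx]
  have hA0 : 0 ≤ A := by positivity
  have hB0 : 0 ≤ B := by positivity
  refine seminorm_le_bound ℂ k n _ (by positivity) fun y => ?_
  rw [le_div_iff₀' hx]
  have hmul := norm_iteratedFDeriv_mul_le (n := n) (N := ((⊤ : ℕ∞) : WithTop ℕ∞)) (χ.smooth ⊤)
    ((compSubConstCLM ℂ x φ).smooth ⊤) y (mod_cast le_top)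
  -- The weight in `x` is shared: `χ` pays for `(1 + ‖y‖) ^ M` along with `‖y‖ ^ k`, and the
  -- translate of `φ` pays for `(1 + ‖y - x‖) ^ M`.
  have hw : (1 + ‖x‖) ^ M ≤ (1 + ‖y‖) ^ M * (1 + ‖y - x‖) ^ M := by
    rw [← mul_pow]
    have := one_add_norm_add_le y (-(y - x))
    rw [norm_neg, show y + -(y - x) = x by abel] at this
    exact pow_le_pow_left₀ (by positivity) this M
  have hy : ‖y‖ ^ k ≤ (1 + ‖y‖) ^ k := pow_le_pow_left₀ (norm_nonneg _) (by linarith) _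
  calc (1 + ‖x‖) ^ M * (‖y‖ ^ k *
        ‖iteratedFDeriv ℝ n (mulSchwartz χ (compSubConstCLM ℂ x φ)) y‖)
      ≤ ((1 + ‖y‖) ^ M * (1 + ‖y - x‖) ^ M) * ((1 + ‖y‖) ^ k *
        ∑ i ∈ Finset.range (n + 1), (n.choose i : ℝ) * ‖iteratedFDeriv ℝ i χ y‖ *
          ‖iteratedFDeriv ℝ (n - i) (compSubConstCLM ℂ x φ) y‖) := by
        gcongr
        exact hmul
    _ = ∑ i ∈ Finset.range (n + 1), (n.choose i : ℝ) *
        (((1 + ‖y‖) ^ (M + k) * ‖iteratedFDeriv ℝ i χ y‖) *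
          ((1 + ‖y - x‖) ^ M * ‖iteratedFDeriv ℝ (n - i) φ (y - x)‖)) := by
        rw [Finset.mul_sum, Finset.mul_sum]
        refine Finset.sum_congr rfl fun i _ => ?_
        rw [iteratedFDeriv_compSubConst, pow_add]
        ring
    _ ≤ _ := by
        gcongr with i hi
        · exact one_add_le_sup_seminorm_apply (𝕜 := ℂ) (m := (M + k, n)) le_rfl
            (Nat.lt_succ_iff.1 (Finset.mem_range.1 hi)) χ y
        · exact one_add_le_sup_seminorm_apply (𝕜 := ℂ) (m := (M, n)) le_rfl
            (Nat.sub_le _ _) φ (y - x)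

theorem exists_bound_mulSchwartz_compSubConst (χ φ : 𝓢(Rd d, ℂ)) (M : ℕ)
    (q : Seminorm ℂ 𝓢(Rd d, ℂ)) (hq : Continuous q) :
    ∃ C, ∀ x : Rd d, (1 + ‖x‖) ^ M * q (mulSchwartz χ (compSubConstCLM ℂ x φ)) ≤ C :=
  exists_bound_of_forall_seminorm _ (fun x : Rd d => (1 + ‖x‖) ^ M)
    (exists_bound_seminorm_mulSchwartz_compSubConst χ φ M) q hq fun _ => by positivity

/-- The short-time Fourier transform of a compactly supported distribution decays rapidly in the
position variable, with a loss in the frequency variable that does not depend on the rate. -/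
theorem exists_bound_map_modulate_mulSchwartz (L : 𝓢(Rd d, ℂ) →L[ℂ] ℂ) (χ φ : 𝓢(Rd d, ℂ)) :
    ∃ k : ℕ, ∀ M : ℕ, ∃ C, ∀ x ξ : Rd d,
      (1 + ‖x‖) ^ M * ‖L (modulate ξ (mulSchwartz χ (compSubConstCLM ℂ x φ)))‖ ≤
        C * (1 + ‖ξ‖) ^ k := by
  obtain ⟨k, q, hq, h⟩ := exists_norm_map_modulate_le L
  refine ⟨k, fun M => ?_⟩
  obtain ⟨C, hC⟩ := exists_bound_mulSchwartz_compSubConst χ φ M q hq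
  refine ⟨C, fun x ξ => ?_⟩
  calc _ ≤ (1 + ‖x‖) ^ M * ((1 + ‖ξ‖) ^ k * q (mulSchwartz χ (compSubConstCLM ℂ x φ))) := by
        gcongr
        exact h _ _
    _ = ((1 + ‖x‖) ^ M * q (mulSchwartz χ (compSubConstCLM ℂ x φ))) * (1 + ‖ξ‖) ^ k := by ring
    _ ≤ _ := by
        gcongr
        exact hC x

/-- The short-time Fourier transform of a Schwartz function decays rapidly. -/
theorem exists_bound_fourierInv_mulSchwartz (g φ : 𝓢(Rd d, ℂ)) (M N : ℕ) :
    ∃ C, ∀ x ζ : Rd d, (1 + ‖x‖) ^ M * ((1 + ‖ζ‖) ^ N *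
      ‖𝓕⁻ (mulSchwartz g (compSubConstCLM ℂ x φ)) ζ‖) ≤ C := by
  have hbase : ∀ j : ℕ, ∃ C, ∀ x : Rd d, (1 + ‖x‖) ^ M *
      SchwartzMap.seminorm ℂ j 0 (𝓕⁻ (mulSchwartz g (compSubConstCLM ℂ x φ))) ≤ C := fun j =>
    exists_bound_mulSchwartz_compSubConst g φ M
      ((SchwartzMap.seminorm ℂ j 0 : Seminorm ℂ 𝓢(Rd d, ℂ)).comp (fourierInvCLM ℂ 𝓢(Rd d, ℂ)).toLinearMap)
      ((continuous_seminorm j 0).comp (fourierInvCLM ℂ 𝓢(Rd d, ℂ)).continuous)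
  obtain ⟨C0, h0⟩ := hbase 0
  obtain ⟨C1, h1⟩ := hbase N
  refine ⟨2 ^ N * (C0 + C1), fun x ζ => ?_⟩
  set G := 𝓕⁻ (mulSchwartz g (compSubConstCLM ℂ x φ))
  have hpow : (1 + ‖ζ‖) ^ N ≤ 2 ^ N * (1 + ‖ζ‖ ^ N) := by
    refine (add_pow_le zero_le_one (norm_nonneg _) N).trans ?_
    rw [one_pow]
    gcongr
    · norm_num
    · omega
  have h2 := norm_le_seminorm ℂ G ζ
  have h3 := norm_pow_mul_le_seminorm ℂ G N ζ
  calc _ ≤ (1 + ‖x‖) ^ M * (2 ^ N * (1 + ‖ζ‖ ^ N) * ‖G ζ‖) := by gcongr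
    _ = 2 ^ N * ((1 + ‖x‖) ^ M * (‖G ζ‖ + ‖ζ‖ ^ N * ‖G ζ‖)) := by ring
    _ ≤ 2 ^ N * ((1 + ‖x‖) ^ M * (SchwartzMap.seminorm ℂ 0 0 G + SchwartzMap.seminorm ℂ N 0 G)) := by
        gcongr
    _ ≤ _ := by
        rw [mul_add]
        gcongr
        · exact h0 x
        · exact h1 x

end Bounds

/-! ### Stability of conic decay under multiplication -/

section Microlocal

variable {d : ℕ}

/-- Microlocal decay is stable under multiplication by smooth functions, locally uniformly along
the translates of a fixed window. -/
theorem exists_bound_localized (L : 𝓢(Rd d, ℂ) →L[ℂ] ℂ) (a g φ : 𝓢(Rd d, ℂ)) {Γ Γ' : Set (Rd d)}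
    (hΓ : ∀ N : ℕ, ∃ C : ℝ, ∀ ξ ∈ Γ, (1 + ‖ξ‖) ^ N * ‖L (modulate (-ξ) a)‖ ≤ C)
    {c : ℝ} (hc : 0 < c) (hΓ' : ∀ ξ ∈ Γ', ∀ η ∉ Γ, c * ‖ξ‖ ≤ ‖ξ - η‖) (N : ℕ) :
    ∃ C : ℝ, ∀ x : Rd d, ∀ ξ ∈ Γ', (1 + ‖ξ‖) ^ N *
      ‖L (modulate (-ξ) (mulSchwartz a (mulSchwartz g (compSubConstCLM ℂ x φ))))‖ ≤ C := by
  obtain ⟨k, q, -, hq⟩ := exists_norm_map_modulate_le L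
  obtain ⟨C1, hC1⟩ := hΓ N
  set A := q a
  have hA : 0 ≤ A := apply_nonneg q a
  -- With `7 ≥ 2π`: if `η = ξ + 2πζ` leaves `Γ`, then `c‖ξ‖ ≤ 2π‖ζ‖`, so `1 + ‖ξ‖ ≤ B (1 + ‖ζ‖)`.
  set B : ℝ := 1 + 7 / c
  have hB : 0 < B := by positivity
  have hpi : 2 * Real.pi ≤ 7 := by linarith [Real.pi_lt_d2]
  -- Outside `Γ`, `1 + ‖η‖` is quadratic in `1 + ‖ζ‖`, and the growth of `L` raises it to the power
  -- `k`.
  set K := N + 2 * k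
  set D : ℝ := 7 ^ N * |C1| + B ^ N * (7 * B) ^ k * A
  have hD : 0 ≤ D := by positivity
  have key : ∀ ξ ∈ Γ', ∀ ζ : Rd d, (1 + ‖ξ‖) ^ N *
      ‖L (modulate (-ξ + -(2 * Real.pi) • ζ) a)‖ ≤ D * (1 + ‖ζ‖) ^ K := by
    intro ξ hξ ζ
    set η : Rd d := ξ + (2 * Real.pi) • ζ
    have hη : -ξ + -(2 * Real.pi) • ζ = -η := by simp only [η]; module
    rw [hη]
    have h7 : 1 + ‖(2 * Real.pi) • ζ‖ ≤ 7 * (1 + ‖ζ‖) := by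
      rw [norm_smul, Real.norm_of_nonneg (by positivity)]
      nlinarith [norm_nonneg ζ]
    have hζ1 : 1 ≤ 1 + ‖ζ‖ := by linarith [norm_nonneg ζ]
    -- Inside `Γ` the assumed decay applies; outside, `ζ` is at least comparable to `ξ`, and
    -- polynomial growth suffices because a power of `1 + ‖ζ‖` is allowed.
    by_cases hmem : η ∈ Γ
    · have h1 : 1 + ‖ξ‖ ≤ (1 + ‖η‖) * (7 * (1 + ‖ζ‖)) := by
        have := one_add_norm_add_le η (-((2 * Real.pi) • ζ))
        rw [show η + -((2 * Real.pi) • ζ) = ξ by simp only [η]; module, norm_neg] at this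
        exact this.trans (by gcongr)
      calc (1 + ‖ξ‖) ^ N * ‖L (modulate (-η) a)‖
          ≤ ((1 + ‖η‖) * (7 * (1 + ‖ζ‖))) ^ N * ‖L (modulate (-η) a)‖ := by gcongr
        _ = 7 ^ N * (1 + ‖ζ‖) ^ N * ((1 + ‖η‖) ^ N * ‖L (modulate (-η) a)‖) := by
          rw [mul_pow, mul_pow]; ring
        _ ≤ 7 ^ N * (1 + ‖ζ‖) ^ K * |C1| := by
          gcongr
          · omega
          · exact (hC1 η hmem).trans (le_abs_self _)
        _ = 7 ^ N * |C1| * (1 + ‖ζ‖) ^ K := by ring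
        _ ≤ D * (1 + ‖ζ‖) ^ K := by
          gcongr
          exact le_add_of_nonneg_right (by positivity)
    · have h1 : 1 + ‖ξ‖ ≤ B * (1 + ‖ζ‖) := by
        have h2 := hΓ' ξ hξ η hmem
        rw [show ξ - η = -((2 * Real.pi) • ζ) by simp only [η]; module, norm_neg, norm_smul,
          Real.norm_of_nonneg (by positivity)] at h2
        have h3 : ‖ξ‖ ≤ 7 / c * ‖ζ‖ := by
          rw [div_mul_eq_mul_div, le_div_iff₀ hc]
          nlinarith [norm_nonneg ζ]
        have h4 : 0 < 7 / c := by positivity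
        simp only [B]
        nlinarith [norm_nonneg ζ]
      have h2 : 1 + ‖-η‖ ≤ (7 * B) * (1 + ‖ζ‖) ^ 2 := by
        rw [norm_neg]
        calc 1 + ‖η‖ ≤ (1 + ‖ξ‖) * (1 + ‖(2 * Real.pi) • ζ‖) := one_add_norm_add_le _ _
          _ ≤ (B * (1 + ‖ζ‖)) * (7 * (1 + ‖ζ‖)) := by gcongr
          _ = _ := by ring
      calc (1 + ‖ξ‖) ^ N * ‖L (modulate (-η) a)‖
          ≤ (B * (1 + ‖ζ‖)) ^ N * ((1 + ‖-η‖) ^ k * A) := by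
            gcongr
            exact hq _ _
        _ ≤ (B * (1 + ‖ζ‖)) ^ N * (((7 * B) * (1 + ‖ζ‖) ^ 2) ^ k * A) := by gcongr
        _ = B ^ N * (7 * B) ^ k * A * (1 + ‖ζ‖) ^ K := by
          simp only [K]
          rw [mul_pow, mul_pow (7 * B), ← pow_mul, pow_add]
          ring
        _ ≤ D * (1 + ‖ζ‖) ^ K := by
          gcongr
          exact le_add_of_nonneg_left (by positivity)
  -- The kernel `𝓕⁻ G` must absorb `(1 + ‖ζ‖) ^ K` and leave an integrable power over.
  set n := (volume : Measure (Rd d)).integrablePower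
  obtain ⟨C2, hC2⟩ := exists_bound_fourierInv_mulSchwartz g φ 0 (K + n)
  have hint : Integrable (fun ζ : Rd d => D * |C2| * (1 + ‖ζ‖) ^ (-(n : ℝ))) :=
    (Measure.integrable_pow_neg_integrablePower volume).const_mul _
  refine ⟨∫ ζ : Rd d, D * |C2| * (1 + ‖ζ‖) ^ (-(n : ℝ)), fun x ξ hξ => ?_⟩
  set G := mulSchwartz g (compSubConstCLM ℂ x φ)
  have hrep := map_mulSchwartz (L ∘L modulate (-ξ)) a G
  simp only [ContinuousLinearMap.comp_apply, modulate_modulate] at hrep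
  rw [hrep, show (1 + ‖ξ‖) ^ N = ‖((1 + ‖ξ‖) ^ N : ℝ)‖ from
    (Real.norm_of_nonneg (by positivity)).symm, ← norm_smul, ← integral_smul]
  refine norm_integral_le_of_norm_le hint (.of_forall fun ζ => ?_)
  rw [norm_smul, Real.norm_of_nonneg (by positivity), norm_mul]
  have h1 := key ξ hξ ζ
  have h2 := hC2 x ζ
  rw [pow_zero, one_mul] at h2
  have hpos : 0 < (1 + ‖ζ‖) ^ n := by positivity
  rw [Real.rpow_neg (by positivity), Real.rpow_natCast, ← div_eq_mul_inv, le_div_iff₀ hpos]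
  calc (1 + ‖ξ‖) ^ N * (‖𝓕⁻ G ζ‖ * ‖L (modulate (-ξ + -(2 * Real.pi) • ζ) a)‖) * (1 + ‖ζ‖) ^ n
      = ((1 + ‖ξ‖) ^ N * ‖L (modulate (-ξ + -(2 * Real.pi) • ζ) a)‖) *
        ((1 + ‖ζ‖) ^ n * ‖𝓕⁻ G ζ‖) := by ring
    _ ≤ (D * (1 + ‖ζ‖) ^ K) * ((1 + ‖ζ‖) ^ n * ‖𝓕⁻ G ζ‖) := by gcongr
    _ = D * ((1 + ‖ζ‖) ^ (K + n) * ‖𝓕⁻ G ζ‖) := by rw [pow_add]; ring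
    _ ≤ D * |C2| := by
      gcongr
      exact h2.trans (le_abs_self _)

/-- Every direction of an open cone has a conic neighbourhood well inside the cone. -/
theorem exists_subcone {Γ : Set (Rd d)} (hΓ : IsOpenCone Γ) {ξ₀ : Rd d} (hξ₀ : ξ₀ ∈ Γ) :
    ∃ Γ' : Set (Rd d), IsOpenCone Γ' ∧ ξ₀ ∈ Γ' ∧
      ∃ c : ℝ, 0 < c ∧ ∀ ξ ∈ Γ', ∀ η ∉ Γ, c * ‖ξ‖ ≤ ‖ξ - η‖ := by
  obtain ⟨ε, hε, hball⟩ := Metric.isOpen_iff.1 hΓ.isOpen ξ₀ hξ₀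
  -- The cone over the half-radius ball. Once `t • ξ` is in that ball, `t • η` is outside the full
  -- ball, so `t‖ξ - η‖ ≥ ε / 2` while `t‖ξ‖ ≤ ‖ξ₀‖ + ε / 2`; `c` is the ratio.
  refine ⟨{ξ | ∃ t : ℝ, 0 < t ∧ t • ξ ∈ Metric.ball ξ₀ (ε / 2)}, ⟨?_, ?_, ?_⟩, ?_,
    (ε / 2) / (‖ξ₀‖ + ε / 2), by positivity, ?_⟩
  · have : {ξ : Rd d | ∃ t : ℝ, 0 < t ∧ t • ξ ∈ Metric.ball ξ₀ (ε / 2)} =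
        ⋃ t : Set.Ioi (0 : ℝ), (fun ξ : Rd d => t.1 • ξ) ⁻¹' Metric.ball ξ₀ (ε / 2) := by
      ext; simp
    rw [this]
    exact isOpen_iUnion fun t => Metric.isOpen_ball.preimage (continuous_const_smul _)
  · rintro ⟨t, -, h⟩
    rw [smul_zero] at h
    exact hΓ.zero_notMem (hball (Metric.ball_subset_ball (by linarith) h))
  · rintro ξ ⟨t, ht, h⟩ s hs
    refine ⟨t / s, by positivity, ?_⟩
    rwa [smul_smul, div_mul_cancel₀ _ hs.ne']
  · exact ⟨1, one_pos, by simpa using by positivity⟩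
  · rintro ξ ⟨t, ht, h⟩ η hη
    have hη' : t • η ∉ Metric.ball ξ₀ ε := fun h' => hη <| by
      have := hΓ.smul_mem _ (hball h') t⁻¹ (by positivity)
      rwa [smul_smul, inv_mul_cancel₀ ht.ne', one_smul] at this
    rw [Metric.mem_ball, dist_eq_norm] at h
    rw [Metric.mem_ball, dist_eq_norm, not_lt] at hη'
    have h1 : ε / 2 ≤ t * ‖ξ - η‖ := by
      have h2 : ‖t • (ξ - η)‖ = t * ‖ξ - η‖ := by rw [norm_smul, Real.norm_of_nonneg ht.le]
      have h3 := norm_sub_norm_le (t • η - ξ₀) (t • ξ - ξ₀)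
      rw [show t • η - ξ₀ - (t • ξ - ξ₀) = -(t • (ξ - η)) by module, norm_neg, h2] at h3
      linarith
    have h4 : t * ‖ξ‖ ≤ ‖ξ₀‖ + ε / 2 := by
      have h5 := norm_add_le (t • ξ - ξ₀) ξ₀
      rw [sub_add_cancel, norm_smul, Real.norm_of_nonneg ht.le] at h5
      linarith
    rw [div_mul_eq_mul_div, div_le_iff₀ (by positivity)]
    refine le_of_mul_le_mul_left ?_ ht
    calc t * (ε / 2 * ‖ξ‖) = ε / 2 * (t * ‖ξ‖) := by ring
      _ ≤ (t * ‖ξ - η‖) * (‖ξ₀‖ + ε / 2) := by gcongr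
      _ = _ := by ring

end Microlocal

/-! ### Finite decompositions, supports and cut-offs -/

section Supports

variable {d : ℕ}

/-- A compactly supported smooth function is a combination of finitely many members of any family
of Schwartz functions without common zeros on its support. -/
theorem exists_eq_sum_mulSchwartz (G : 𝓢(Rd d, ℂ)) (hG : HasCompactSupport G)
    (a : Rd d → 𝓢(Rd d, ℂ)) (ha : ∀ x ∈ tsupport G, a x x ≠ 0) :
    ∃ (t : Finset (Rd d)) (g : Rd d → 𝓢(Rd d, ℂ)), (∀ x ∈ t, x ∈ tsupport G) ∧
      G = ∑ x ∈ t, mulSchwartz (a x) (g x) := by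
  obtain ⟨t, ht, hcov⟩ := hG.isCompact.elim_nhds_subcover (fun x => {y | a x y ≠ 0})
    fun x hx => (isOpen_ne_fun (a x).continuous continuous_const).mem_nhds (ha x hx)
  -- `S = ∑ |a x|²` is positive on the support of `G`, so the coefficients can be `conj (a x) · G /
  -- S`.
  set S : Rd d → ℂ := fun y => ∑ x ∈ t, (starRingEnd ℂ) (a x y) * a x y with hS
  have hconj : ∀ x, ContDiff ℝ ∞ fun y => (starRingEnd ℂ) (a x y) := fun x =>
    Complex.conjCLE.contDiff.comp ((a x).smooth ⊤)
  have hSd : ContDiff ℝ ∞ S := ContDiff.sum fun x _ => (hconj x).mul ((a x).smooth ⊤)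
  have hS0 : ∀ y ∈ tsupport G, S y ≠ 0 := by
    intro y hy
    obtain ⟨x, hx, hxy⟩ := Set.mem_iUnion₂.1 (hcov hy)
    have h1 : S y = ((∑ x ∈ t, ‖a x y‖ ^ 2 : ℝ) : ℂ) := by
      simp only [hS]
      push_cast
      exact Finset.sum_congr rfl fun x _ => Complex.conj_mul' _
    rw [h1, Complex.ofReal_ne_zero]
    refine (Finset.sum_pos' (fun _ _ => by positivity) ⟨x, hx, ?_⟩).ne'
    have : a x y ≠ 0 := hxy
    positivity
  -- Zeros of `S` are harmless: they lie off `tsupport G`, near which the quotient is identically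
  -- zero.
  have hGS : ContDiff ℝ ∞ fun y => G y / S y := by
    rw [contDiff_iff_contDiffAt]
    intro y
    by_cases hy : y ∈ tsupport G
    · simp only [div_eq_mul_inv]
      exact (G.smooth ⊤).contDiffAt.mul (hSd.contDiffAt.inv (hS0 y hy))
    · have h0 := notMem_tsupport_iff_eventuallyEq.1 hy
      refine (contDiffAt_const (c := (0 : ℂ))).congr_of_eventuallyEq ?_
      filter_upwards [h0] with z hz
      simp [hz]
  have hGSc : HasCompactSupport fun y => G y / S y := by
    simp only [div_eq_mul_inv]
    exact hG.mul_right (f' := fun y => (S y)⁻¹)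
  have hg : ∀ x, HasCompactSupport fun y => (starRingEnd ℂ) (a x y) * (G y / S y) := fun x =>
    hGSc.mul_left
  refine ⟨t, fun x => (hg x).toSchwartzMap ((hconj x).mul hGS), ht, ?_⟩
  ext y
  have hsum : (∑ x ∈ t, mulSchwartz (a x) ((hg x).toSchwartzMap ((hconj x).mul hGS))) y =
      ∑ x ∈ t, a x y * ((starRingEnd ℂ) (a x y) * (G y / S y)) := by
    simp
  rw [hsum]
  by_cases hy : y ∈ tsupport G
  · have h2 : ∑ x ∈ t, a x y * ((starRingEnd ℂ) (a x y) * (G y / S y)) = S y * (G y / S y) := by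
      rw [hS, Finset.sum_mul]
      exact Finset.sum_congr rfl fun x _ => by ring
    rw [h2, mul_div_cancel₀ _ (hS0 y hy)]
  · simp [image_eq_zero_of_notMem_tsupport hy]

/-- A smooth bump function, as a Schwartz function. -/
def bumpSchwartz {c : Rd d} (b : ContDiffBump c) : 𝓢(Rd d, ℂ) :=
  (b.hasCompactSupport.comp_left (g := Complex.ofReal) rfl).toSchwartzMap
    (Complex.ofRealCLM.contDiff.comp b.contDiff)

theorem bumpSchwartz_apply {c : Rd d} (b : ContDiffBump c) (y : Rd d) :
    bumpSchwartz b y = (b y : ℂ) := rfl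

theorem hasCompactSupport_bumpSchwartz {c : Rd d} (b : ContDiffBump c) :
    HasCompactSupport (bumpSchwartz b) :=
  b.hasCompactSupport.comp_left (g := Complex.ofReal) rfl

theorem tsupport_bumpSchwartz_subset {c : Rd d} (b : ContDiffBump c) :
    tsupport (bumpSchwartz b) ⊆ Metric.closedBall c b.rOut :=
  (tsupport_comp_subset (g := Complex.ofReal) rfl b).trans b.tsupport_eq.subset

theorem tsupport_mulSchwartz_subset_left (f g : 𝓢(Rd d, ℂ)) :
    tsupport (mulSchwartz f g) ⊆ tsupport f :=
  closure_mono fun y hy hf => hy (by simp [hf])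

theorem tsupport_mulSchwartz_subset_right (f g : 𝓢(Rd d, ℂ)) :
    tsupport (mulSchwartz f g) ⊆ tsupport g :=
  closure_mono fun y hy hg => hy (by simp [hg])

/-- The dilation `y ↦ β (r y)` of a Schwartz function. -/
def dilate (r : ℝ) (hr : r ≠ 0) (β : 𝓢(Rd d, ℂ)) : 𝓢(Rd d, ℂ) :=
  compCLMOfContinuousLinearEquiv ℂ (ContinuousLinearEquiv.smulLeft (Units.mk0 r hr)) β

theorem dilate_apply (r : ℝ) (hr : r ≠ 0) (β : 𝓢(Rd d, ℂ)) (y : Rd d) :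
    dilate r hr β y = β (r • y) := rfl

/-- For `i = 0` the mean value inequality gives a factor `‖r • y‖`; for `i ≥ 1` the chain rule gives
`r ^ i ≤ r`. The growth `1 + ‖y‖` costs one extra weight when multiplying by a Schwartz function. -/
theorem norm_iteratedFDeriv_dilate_sub_one_le (β : 𝓢(Rd d, ℂ)) (hβ : β 0 = 1) (i : ℕ) :
    ∃ C, 0 ≤ C ∧ ∀ (r : ℝ) (hr : 0 < r), r ≤ 1 → ∀ y : Rd d,
      ‖iteratedFDeriv ℝ i (fun z => dilate r hr.ne' β z - 1) y‖ ≤ C * r * (1 + ‖y‖) := by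
  rcases i with - | i
  · refine ⟨SchwartzMap.seminorm ℂ 0 1 β, apply_nonneg _ _, fun r hr hr1 y => ?_⟩
    rw [norm_iteratedFDeriv_zero, dilate_apply, ← hβ]
    have h := (convex_univ (𝕜 := ℝ) (E := Rd d)).norm_image_sub_le_of_norm_fderiv_le (𝕜 := ℝ)
      (f := β) (C := SchwartzMap.seminorm ℂ 0 1 β) (fun z _ => β.differentiableAt)
      (fun z _ => by
        rw [← norm_iteratedFDeriv_one]
        exact norm_iteratedFDeriv_le_seminorm ℂ β 1 z) (Set.mem_univ 0) (Set.mem_univ (r • y))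
    refine h.trans ?_
    rw [sub_zero, norm_smul, Real.norm_of_nonneg hr.le, mul_assoc]
    gcongr
    linarith
  · refine ⟨SchwartzMap.seminorm ℂ 0 (i + 1) β, apply_nonneg _ _, fun r hr hr1 y => ?_⟩
    have h1 : iteratedFDeriv ℝ (i + 1) (fun z => dilate r hr.ne' β z - 1) y =
        iteratedFDeriv ℝ (i + 1) (dilate r hr.ne' β) y := by
      have h := iteratedFDeriv_sub_apply (𝕜 := ℝ) (i := i + 1) (x := y)
        (f := dilate r hr.ne' β) (g := fun _ => (1 : ℂ))
        (((dilate r hr.ne' β).smooth ⊤).contDiffAt.of_le (mod_cast le_top)) contDiffAt_const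
      rw [iteratedFDeriv_const_of_ne (Nat.succ_ne_zero i), Pi.zero_apply, sub_zero] at h
      exact h
    rw [h1]
    have h2 := (r • ContinuousLinearMap.id ℝ (Rd d)).iteratedFDeriv_comp_right (f := β)
      (β.smooth ⊤) y (i := i + 1) (mod_cast le_top)
    have h3 : iteratedFDeriv ℝ (i + 1) (dilate r hr.ne' β) y = _ := h2
    rw [h3]
    refine (ContinuousMultilinearMap.norm_compContinuousLinearMap_le _ _).trans ?_
    have hn : ‖r • ContinuousLinearMap.id ℝ (Rd d)‖ ≤ r := by
      rw [norm_smul, Real.norm_of_nonneg hr.le]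
      exact mul_le_of_le_one_right hr.le ContinuousLinearMap.norm_id_le
    have hp : ∏ _j : Fin (i + 1), ‖r • ContinuousLinearMap.id ℝ (Rd d)‖ ≤ r := by
      rw [Finset.prod_const, Finset.card_univ, Fintype.card_fin]
      refine (pow_le_pow_left₀ (norm_nonneg _) hn _).trans ?_
      exact pow_le_of_le_one hr.le hr1 (Nat.succ_ne_zero i)
    rw [mul_assoc]
    refine mul_le_mul (norm_iteratedFDeriv_le_seminorm ℂ β _ _) ?_ (by positivity)
      (apply_nonneg _ _)
    exact hp.trans (le_mul_of_one_le_right hr.le (by linarith [norm_nonneg y]))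

theorem exists_seminorm_dilate_mul_sub_le (β f : 𝓢(Rd d, ℂ)) (hβ : β 0 = 1) (k n : ℕ) :
    ∃ C, ∀ (r : ℝ) (hr : 0 < r), r ≤ 1 →
      SchwartzMap.seminorm ℂ k n (mulSchwartz (dilate r hr.ne' β) f - f) ≤ C * r := by
  choose A hA0 hA using norm_iteratedFDeriv_dilate_sub_one_le β hβ
  refine ⟨∑ i ∈ Finset.range (n + 1), (n.choose i : ℝ) * (A i *
    (SchwartzMap.seminorm ℂ k (n - i) f + SchwartzMap.seminorm ℂ (k + 1) (n - i) f)),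
    fun r hr hr1 => ?_⟩
  have hnn : ∀ i, 0 ≤ SchwartzMap.seminorm ℂ k (n - i) f +
      SchwartzMap.seminorm ℂ (k + 1) (n - i) f := fun i =>
    add_nonneg (apply_nonneg _ _) (apply_nonneg _ _)
  refine seminorm_le_bound ℂ k n _ (mul_nonneg (Finset.sum_nonneg fun i _ =>
    mul_nonneg (Nat.cast_nonneg _) (mul_nonneg (hA0 i) (hnn i))) hr.le) fun y => ?_
  have hfun : ((mulSchwartz (dilate r hr.ne' β) f - f : 𝓢(Rd d, ℂ)) : Rd d → ℂ) =
      fun z => (dilate r hr.ne' β z - 1) * f z := by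
    funext z
    simp [sub_mul]
  rw [hfun]
  have hmul := norm_iteratedFDeriv_mul_le (n := n) (N := ((⊤ : ℕ∞) : WithTop ℕ∞))
    (((dilate r hr.ne' β).smooth ⊤).sub contDiff_const) (f.smooth ⊤) y (mod_cast le_top)
    (f := fun z => dilate r hr.ne' β z - 1)
  refine (mul_le_mul_of_nonneg_left hmul (by positivity)).trans ?_
  rw [Finset.mul_sum, Finset.sum_mul]
  refine Finset.sum_le_sum fun i _ => ?_
  have h1 := le_seminorm ℂ k (n - i) f y
  have h2 := le_seminorm ℂ (k + 1) (n - i) f y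
  calc ‖y‖ ^ k * ((n.choose i : ℝ) *
        ‖iteratedFDeriv ℝ i (fun z => dilate r hr.ne' β z - 1) y‖ * ‖iteratedFDeriv ℝ (n - i) f y‖)
      ≤ ‖y‖ ^ k * ((n.choose i : ℝ) * (A i * r * (1 + ‖y‖)) * ‖iteratedFDeriv ℝ (n - i) f y‖) := by
        gcongr
        exact hA i r hr hr1 y
    _ = (n.choose i : ℝ) * (A i * (‖y‖ ^ k * ‖iteratedFDeriv ℝ (n - i) f y‖ +
        ‖y‖ ^ (k + 1) * ‖iteratedFDeriv ℝ (n - i) f y‖)) * r := by ring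
    _ ≤ _ := by
        gcongr
        exact hA0 i

/-- Schwartz functions are limits of cut-offs. -/
theorem exists_tendsto_hasCompactSupport (f : 𝓢(Rd d, ℂ)) :
    ∃ F : ℕ → 𝓢(Rd d, ℂ), (∀ j, HasCompactSupport (F j)) ∧ (∀ j, tsupport (F j) ⊆ tsupport f) ∧
      Tendsto F atTop (𝓝 f) := by
  let b : ContDiffBump (0 : Rd d) := ⟨1, 2, one_pos, one_lt_two⟩
  set β := bumpSchwartz b
  have hβ : β 0 = 1 := by
    rw [bumpSchwartz_apply, b.one_of_mem_closedBall (by simpa using b.rIn_pos.le),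
      Complex.ofReal_one]
  have hr : ∀ j : ℕ, 0 < ((j : ℝ) + 1)⁻¹ := fun j => by positivity
  refine ⟨fun j => mulSchwartz (dilate _ (hr j).ne' β) f, fun j => ?_,
    fun j => tsupport_mulSchwartz_subset_right _ _, ?_⟩
  · have h1 : HasCompactSupport (dilate _ (hr j).ne' β) :=
      (hasCompactSupport_bumpSchwartz b).comp_homeomorph
        (Homeomorph.smulOfNeZero _ (hr j).ne')
    exact h1.mono' ((subset_tsupport _).trans (tsupport_mulSchwartz_subset_left _ _))
  · rw [(schwartz_withSeminorms ℂ (Rd d) ℂ).tendsto_nhds]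
    intro i ε hε
    obtain ⟨C, hC⟩ := exists_seminorm_dilate_mul_sub_le β f hβ i.1 i.2
    have hlim : Tendsto (fun j : ℕ => C * ((j : ℝ) + 1)⁻¹) atTop (𝓝 0) := by
      have := (tendsto_one_div_add_atTop_nhds_zero_nat (𝕜 := ℝ)).const_mul C
      simpa using this
    filter_upwards [hlim.eventually (gt_mem_nhds hε)] with j hj
    exact (hC _ (hr j) (inv_le_one_of_one_le₀ (by linarith [j.cast_nonneg (α := ℝ)]))).trans_lt hj

/-- A tempered distribution vanishes on the Schwartz functions whose support is disjoint from its
own support. -/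
theorem map_eq_zero_of_disjoint_dsupport (v : 𝓢'(Rd d, ℂ)) (G : 𝓢(Rd d, ℂ))
    (h : Disjoint (tsupport G) (Distribution.dsupport v)) : v G = 0 := by
  -- For compact support, `F` is a finite sum of multiples of bumps, each living where `v` vanishes;
  -- density of cut-offs then gives the general case.
  have hcomp : ∀ F : 𝓢(Rd d, ℂ), HasCompactSupport F → tsupport F ⊆ tsupport G → v F = 0 := by
    intro F hF hFG
    have hloc : ∀ x : Rd d, ∃ a : 𝓢(Rd d, ℂ), x ∈ tsupport F →
        a x ≠ 0 ∧ Distribution.IsVanishingOn v (tsupport a) := by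
      intro x
      by_cases hx : x ∈ tsupport F
      · obtain ⟨s, hs, hso, hxs⟩ := (Distribution.notMem_dsupport_iff x).1
          (Set.disjoint_left.1 h (hFG hx))
        obtain ⟨ε, hε, hball⟩ := Metric.isOpen_iff.1 hso x hxs
        let b : ContDiffBump x := ⟨ε / 4, ε / 2, by linarith, by linarith⟩
        refine ⟨bumpSchwartz b, fun _ => ⟨?_, hs.mono ?_⟩⟩
        · rw [bumpSchwartz_apply, b.one_of_mem_closedBall (by simpa using b.rIn_pos.le)]
          simp
        · exact (tsupport_bumpSchwartz_subset b).trans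
            ((Metric.closedBall_subset_ball (by change ε / 2 < ε; linarith)).trans hball)
      · exact ⟨0, fun h => absurd h hx⟩
    choose a ha using hloc
    obtain ⟨t, g, ht, hsum⟩ := exists_eq_sum_mulSchwartz F hF a fun x hx => (ha x hx).1
    rw [hsum, map_sum]
    refine Finset.sum_eq_zero fun x hx => ?_
    exact (ha x (ht x hx)).2 _ (tsupport_mulSchwartz_subset_left _ _)
  obtain ⟨F, hF, hFG, hlim⟩ := exists_tendsto_hasCompactSupport G
  have h1 := (ContinuousLinearMap.continuous (v : 𝓢(Rd d, ℂ) →L[ℂ] ℂ)).tendsto G |>.comp hlim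
  refine tendsto_nhds_unique h1 ?_
  refine tendsto_const_nhds.congr fun j => ?_
  exact (hcomp (F j) (hF j) (hFG j)).symm

/-- A distribution in `𝓔' + 𝓢` is the sum of its localization by a compactly supported smooth
function and a Schwartz function. -/
theorem exists_cutoff {u : 𝓢'(Rd d, ℂ)} (hu : u ∈ compactlySupported d + schwartzFunctions d) :
    ∃ χ f : 𝓢(Rd d, ℂ), HasCompactSupport χ ∧
      ∀ F, u F = u (mulSchwartz χ F) + ∫ y, mulSchwartz f F y := by
  obtain ⟨v, hv, -, ⟨f, rfl⟩, rfl⟩ := hu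
  obtain ⟨R, hR⟩ := (show IsCompact (Distribution.dsupport v) from hv).isBounded.subset_ball 0
  -- Equal to one on a neighbourhood of the support of `v`; the absolute value is there because `R`
  -- may be negative when the support is empty.
  let b : ContDiffBump (0 : Rd d) := ⟨|R| + 1, |R| + 2, by positivity, by linarith⟩
  set χ := bumpSchwartz b
  -- The term `u (χ F)` already contains `χ f`, so the Schwartz remainder is `(1 - χ) f`.
  refine ⟨χ, f - mulSchwartz χ f, hasCompactSupport_bumpSchwartz b, fun F => ?_⟩
  have hv0 : v (F - mulSchwartz χ F) = 0 := by
    refine map_eq_zero_of_disjoint_dsupport v _ ?_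
    rw [Set.disjoint_left]
    intro y hy hyv
    refine notMem_tsupport_iff_eventuallyEq.2 ?_ hy
    have hyR : y ∈ Metric.ball (0 : Rd d) (|R| + 1) :=
      Metric.ball_subset_ball (by linarith [le_abs_self R]) (hR hyv)
    filter_upwards [Metric.isOpen_ball.mem_nhds hyR] with z hz
    have hz1 : b z = 1 := b.one_of_mem_closedBall (Metric.ball_subset_closedBall hz)
    simp [χ, bumpSchwartz_apply, hz1]
  have hv1 : v F = v (mulSchwartz χ F) := by
    rwa [map_sub, sub_eq_zero] at hv0
  have hadd : ∀ F, (v + toTemperedDistributionCLM (Rd d) ℂ volume f) F =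
      v F + ∫ y, F y * f y := fun F => by
    exact congrArg (v F + ·) (toTemperedDistributionCLM_apply_apply volume f F)
  have hint : ∫ y, F y * f y = (∫ y, mulSchwartz χ F y * f y) +
      ∫ y, mulSchwartz (f - mulSchwartz χ f) F y := by
    rw [← integral_add]
    · refine integral_congr_ae (.of_forall fun y => ?_)
      simp
      ring
    · exact (mulSchwartz (mulSchwartz χ F) f).integrable
    · exact (mulSchwartz (f - mulSchwartz χ f) F).integrable
  rw [hadd, hadd, hv1, hint, add_assoc]

end Supports

/-! ### The two wave front sets -/

section WaveFront

variable {d : ℕ}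

/-- Conjugation moves onto the window and reverses the frequency, which brings the transform into
the bilinear form of the estimates above. -/
theorem stft_eq (φ : 𝓢(Rd d, ℂ)) (u : 𝓢'(Rd d, ℂ)) (z : PhaseSpace d) :
    stft φ u z = u (modulate (-z.2) (compSubConstCLM ℂ z.1 (schwartzConj φ))) := by
  refine congrArg u ?_
  ext y
  rw [schwartzConj_apply, timeFreqShift_apply, modulate_apply, compSubConstCLM_apply,
    schwartzConj_apply, map_mul, character, ← Complex.exp_conj]
  simp [inner_neg_right]

theorem integral_mulSchwartz_modulate (f g : 𝓢(Rd d, ℂ)) (ξ : Rd d) :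
    ∫ y, mulSchwartz f (modulate ξ g) y = 𝓕⁻ (mulSchwartz f g) ((2 * Real.pi)⁻¹ • ξ) := by
  rw [fourierInv_coe, Real.fourierInv_eq', mulSchwartz_modulate]
  refine integral_congr_ae (.of_forall fun y => ?_)
  simp only [modulate_apply, character, smul_eq_mul, inner_smul_right]
  congr 2
  push_cast
  field_simp

theorem bracket₂_le (z : PhaseSpace d) : bracket₂ z ≤ (1 + ‖z.1‖) + ‖z.2‖ := by
  refine Real.sqrt_le_iff.2 ⟨by positivity, ?_⟩
  nlinarith [norm_nonneg z.1, norm_nonneg z.2, mul_nonneg (norm_nonneg z.1) (norm_nonneg z.2)]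

theorem one_add_norm_le_bracket (ξ : Rd d) : 1 + ‖ξ‖ ≤ 2 * bracket ξ := by
  have h1 : 1 ≤ bracket ξ := Real.one_le_sqrt.2 (by nlinarith [norm_nonneg ξ])
  have h2 : ‖ξ‖ ≤ bracket ξ := Real.le_sqrt_of_sq_le (by linarith)
  linarith

theorem bracket₂_nonneg (z : PhaseSpace d) : 0 ≤ bracket₂ z := Real.sqrt_nonneg _

/-- The short-time Fourier transform of a Schwartz function decays rapidly on phase space. -/
theorem exists_bound_stft_schwartz (f φ : 𝓢(Rd d, ℂ)) (N : ℕ) :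
    ∃ C : ℝ, ∀ z : PhaseSpace d, bracket₂ z ^ N *
      ‖∫ y, mulSchwartz f (modulate (-z.2) (compSubConstCLM ℂ z.1 φ)) y‖ ≤ C := by
  obtain ⟨C, hC⟩ := exists_bound_fourierInv_mulSchwartz f φ N N
  refine ⟨7 ^ N * C, fun z => ?_⟩
  rw [integral_mulSchwartz_modulate]
  set ζ : Rd d := (2 * Real.pi)⁻¹ • -z.2
  have hζ : ‖z.2‖ ≤ 7 * ‖ζ‖ := by
    have h1 : z.2 = -((2 * Real.pi) • ζ) := by
      rw [smul_inv_smul₀ (by positivity), neg_neg]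
    rw [h1, norm_neg, norm_smul, Real.norm_of_nonneg (by positivity)]
    gcongr
    linarith [Real.pi_lt_d2]
  have hb : bracket₂ z ≤ 7 * ((1 + ‖z.1‖) * (1 + ‖ζ‖)) := by
    refine (bracket₂_le z).trans ?_
    nlinarith [norm_nonneg z.1, norm_nonneg ζ, mul_nonneg (norm_nonneg z.1) (norm_nonneg ζ)]
  have h2 := hC z.1 ζ
  calc _ ≤ (7 * ((1 + ‖z.1‖) * (1 + ‖ζ‖))) ^ N *
        ‖𝓕⁻ (mulSchwartz f (compSubConstCLM ℂ z.1 φ)) ζ‖ := by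
        gcongr
        exact bracket₂_nonneg z
    _ = 7 ^ N * ((1 + ‖z.1‖) ^ N * ((1 + ‖ζ‖) ^ N *
        ‖𝓕⁻ (mulSchwartz f (compSubConstCLM ℂ z.1 φ)) ζ‖)) := by
        rw [mul_pow, mul_pow]; ring
    _ ≤ _ := by gcongr

/-- The Gabor wave front set only depends on a localization of `u` modulo Schwartz functions. -/
theorem notMem_gaborWaveFrontSet {u : 𝓢'(Rd d, ℂ)} {φ χ f : 𝓢(Rd d, ℂ)}
    (hu : ∀ F, u F = u (mulSchwartz χ F) + ∫ y, mulSchwartz f F y)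
    {Γ : Set (PhaseSpace d)} (hΓ : IsOpenCone Γ) {z₀ : PhaseSpace d} (hz₀ : z₀ ∈ Γ)
    (h : ∀ N : ℕ, ∃ C : ℝ, ∀ z ∈ Γ, bracket₂ z ^ N * ‖u (modulate (-z.2)
      (mulSchwartz χ (compSubConstCLM ℂ z.1 (schwartzConj φ))))‖ ≤ C) :
    z₀ ∉ gaborWaveFrontSet φ u := by
  rintro ⟨-, hz⟩
  refine hz ⟨Γ, hΓ, hz₀, fun N => ?_⟩
  obtain ⟨C1, h1⟩ := h N
  obtain ⟨C2, h2⟩ := exists_bound_stft_schwartz f (schwartzConj φ) N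
  refine ⟨C1 + C2, fun z hz => ?_⟩
  rw [stft_eq, hu, mulSchwartz_modulate]
  refine (mul_le_mul_of_nonneg_left (norm_add_le _ _) (pow_nonneg (bracket₂_nonneg z) N)).trans ?_
  rw [mul_add]
  exact add_le_add (h1 z hz) (h2 z)

theorem isOpenCone_norm_lt (R : ℝ) : IsOpenCone {z : PhaseSpace d | ‖z.2‖ < R * ‖z.1‖} where
  isOpen := isOpen_lt (by fun_prop) (by fun_prop)
  zero_notMem := by simp
  smul_mem z hz t ht := by
    have h : ‖z.2‖ < R * ‖z.1‖ := hz
    change ‖t • z.2‖ < R * ‖t • z.1‖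
    rw [norm_smul, norm_smul, mul_left_comm]
    exact mul_lt_mul_of_pos_left h (norm_pos_iff.2 ht.ne')

theorem notMem_gaborWaveFrontSet_of_fst_ne_zero {u : 𝓢'(Rd d, ℂ)} {φ χ f : 𝓢(Rd d, ℂ)}
    (hu : ∀ F, u F = u (mulSchwartz χ F) + ∫ y, mulSchwartz f F y)
    {z₀ : PhaseSpace d} (hz₀ : z₀.1 ≠ 0) : z₀ ∉ gaborWaveFrontSet φ u := by
  have hx : 0 < ‖z₀.1‖ := norm_pos_iff.2 hz₀
  -- Any slope above `‖z₀.2‖ / ‖z₀.1‖` puts `z₀` in the cone.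
  set R : ℝ := (‖z₀.2‖ + 1) / ‖z₀.1‖
  have hR : 0 < R := by positivity
  refine notMem_gaborWaveFrontSet hu (isOpenCone_norm_lt R) (z₀ := z₀) ?_ fun N => ?_
  · change ‖z₀.2‖ < R * ‖z₀.1‖
    rw [div_mul_cancel₀ _ hx.ne']
    linarith
  obtain ⟨k, hk⟩ := exists_bound_map_modulate_mulSchwartz (u : 𝓢(Rd d, ℂ) →L[ℂ] ℂ) χ
    (schwartzConj φ)
  -- In the cone the loss `(1 + ‖ξ‖) ^ k` is bounded by a multiple of `(1 + ‖x‖) ^ k`, so `k` extra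
  -- orders of decay in `x` compensate for it.
  obtain ⟨C, hC⟩ := hk (N + k)
  refine ⟨(1 + R) ^ N * (|C| * (1 + R) ^ k), fun z hz => ?_⟩
  have hz' : ‖z.2‖ ≤ R * ‖z.1‖ := le_of_lt hz
  have hb : bracket₂ z ≤ (1 + R) * (1 + ‖z.1‖) := by
    refine (bracket₂_le z).trans ?_
    nlinarith [norm_nonneg z.1]
  have hξ : 1 + ‖-z.2‖ ≤ (1 + R) * (1 + ‖z.1‖) := by
    rw [norm_neg]
    nlinarith [norm_nonneg z.1]
  set A := ‖u (modulate (-z.2) (mulSchwartz χ (compSubConstCLM ℂ z.1 (schwartzConj φ))))‖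
  have hA : (1 + ‖z.1‖) ^ (N + k) * A ≤ C * (1 + ‖-z.2‖) ^ k := hC z.1 (-z.2)
  have hpos : 0 < (1 + ‖z.1‖) ^ k := by positivity
  refine le_of_mul_le_mul_left ?_ hpos
  calc (1 + ‖z.1‖) ^ k * (bracket₂ z ^ N * A)
      ≤ (1 + ‖z.1‖) ^ k * (((1 + R) * (1 + ‖z.1‖)) ^ N * A) := by
        gcongr
        exact bracket₂_nonneg z
    _ = (1 + R) ^ N * ((1 + ‖z.1‖) ^ (N + k) * A) := by rw [mul_pow, pow_add]; ring
    _ ≤ (1 + R) ^ N * (|C| * ((1 + R) * (1 + ‖z.1‖)) ^ k) := by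
        refine mul_le_mul_of_nonneg_left (hA.trans ?_) (by positivity)
        exact mul_le_mul (le_abs_self C) (pow_le_pow_left₀ (by positivity) hξ k) (by positivity)
          (abs_nonneg C)
    _ = _ := by rw [mul_pow]; ring

/-- The microlocal regularity expressed by the complement of the classical wave front set, in a
form suited for localization. -/
theorem exists_window_of_notMem_waveFrontSet {u : 𝓢'(Rd d, ℂ)} {x₀ ξ₀ : Rd d} (hξ₀ : ξ₀ ≠ 0)
    (h : (x₀, ξ₀) ∉ waveFrontSet u) :
    ∃ (a : 𝓢(Rd d, ℂ)) (Γ : Set (Rd d)), a x₀ ≠ 0 ∧ IsOpenCone Γ ∧ ξ₀ ∈ Γ ∧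
      ∀ N : ℕ, ∃ C : ℝ, ∀ ξ ∈ Γ, (1 + ‖ξ‖) ^ N * ‖u (modulate (-ξ) a)‖ ≤ C := by
  have h' : ∃ (φ : 𝓢(Rd d, ℂ)) (Γ₂ : Set (Rd d)), HasCompactSupport φ ∧ φ 0 ≠ 0 ∧
      IsOpenCone Γ₂ ∧ ξ₀ ∈ Γ₂ ∧
      ∀ N : ℕ, ∃ C : ℝ, ∀ ξ ∈ Γ₂, bracket ξ ^ N * ‖stft φ u (x₀, ξ)‖ ≤ C :=
    not_not.1 fun hn => h ⟨hξ₀, hn⟩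
  obtain ⟨φ, Γ, -, hφ, hΓ, hmem, hdec⟩ := h'
  refine ⟨compSubConstCLM ℂ x₀ (schwartzConj φ), Γ, ?_, hΓ, hmem, fun N => ?_⟩
  · rwa [compSubConstCLM_apply, sub_self, schwartzConj_apply, map_ne_zero]
  · obtain ⟨C, hC⟩ := hdec N
    refine ⟨2 ^ N * C, fun ξ hξ => ?_⟩
    have h1 := hC ξ hξ
    rw [stft_eq] at h1
    calc _ ≤ (2 * bracket ξ) ^ N *
          ‖u (modulate (-ξ) (compSubConstCLM ℂ x₀ (schwartzConj φ)))‖ := by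
          gcongr
          exact one_add_norm_le_bracket ξ
      _ = 2 ^ N * (bracket ξ ^ N *
          ‖u (modulate (-ξ) (compSubConstCLM ℂ x₀ (schwartzConj φ)))‖) := by
          rw [mul_pow, mul_assoc]
      _ ≤ _ := by gcongr

theorem notMem_gaborWaveFrontSet_of_forall_notMem_waveFrontSet {u : 𝓢'(Rd d, ℂ)}
    {φ χ f : 𝓢(Rd d, ℂ)} (hχ : HasCompactSupport χ)
    (hu : ∀ F, u F = u (mulSchwartz χ F) + ∫ y, mulSchwartz f F y) {ξ₀ : Rd d} (hξ₀ : ξ₀ ≠ 0)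
    (h : ∀ x, (x, ξ₀) ∉ waveFrontSet u) : (0, ξ₀) ∉ gaborWaveFrontSet φ u := by
  choose a Γ ha hΓ hmem hdec using fun x => exists_window_of_notMem_waveFrontSet hξ₀ (h x)
  choose Γ' hΓ' hmem' c hc hsep using fun x => exists_subcone (hΓ x) (hmem x)
  obtain ⟨t, g, -, hsum⟩ := exists_eq_sum_mulSchwartz χ hχ a fun x _ => ha x
  refine notMem_gaborWaveFrontSet hu
    -- The first condition makes decay in `ξ` alone control `bracket₂`, and it excludes the origin
    -- even if `t` is empty.
    (Γ := {z | ‖z.1‖ < ‖z.2‖} ∩ ⋂ x ∈ t, Prod.snd ⁻¹' Γ' x) ⟨?_, ?_, ?_⟩ ?_ fun N => ?_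
  · exact (isOpen_lt (by fun_prop) (by fun_prop)).inter
      (isOpen_biInter_finset fun x _ => (hΓ' x).isOpen.preimage continuous_snd)
  · simp
  · rintro z ⟨hz1, hz2⟩ s hs
    refine ⟨?_, Set.mem_iInter₂.2 fun x hx => ?_⟩
    · change ‖s • z.1‖ < ‖s • z.2‖
      rw [norm_smul, norm_smul]
      exact mul_lt_mul_of_pos_left hz1 (norm_pos_iff.2 hs.ne')
    · exact (hΓ' x).smul_mem _ (Set.mem_iInter₂.1 hz2 x hx) s hs
  · exact ⟨by simpa using hξ₀, Set.mem_iInter₂.2 fun x _ => hmem' x⟩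
  choose C hC using fun x => exists_bound_localized (u : 𝓢(Rd d, ℂ) →L[ℂ] ℂ) (a x) (g x)
    (schwartzConj φ) (hdec x) (hc x) (hsep x) N
  refine ⟨2 ^ N * ∑ x ∈ t, C x, fun z hz => ?_⟩
  have hb : bracket₂ z ≤ 2 * (1 + ‖z.2‖) := by
    have h1 : ‖z.1‖ < ‖z.2‖ := hz.1
    linarith [bracket₂_le z]
  have hrep : u (modulate (-z.2) (mulSchwartz χ (compSubConstCLM ℂ z.1 (schwartzConj φ)))) =
      ∑ x ∈ t, u (modulate (-z.2)
        (mulSchwartz (a x) (mulSchwartz (g x) (compSubConstCLM ℂ z.1 (schwartzConj φ))))) := by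
    rw [← map_sum, ← map_sum]
    congr 2
    conv_lhs => rw [hsum]
    rw [map_sum, _root_.sum_apply]
    refine Finset.sum_congr rfl fun x _ => ?_
    ext y
    simp [mul_assoc]
  rw [hrep]
  calc _ ≤ (2 * (1 + ‖z.2‖)) ^ N * ∑ x ∈ t, ‖u (modulate (-z.2) (mulSchwartz (a x)
        (mulSchwartz (g x) (compSubConstCLM ℂ z.1 (schwartzConj φ)))))‖ := by
        gcongr
        · exact bracket₂_nonneg z
        · exact norm_sum_le _ _
    _ = 2 ^ N * ∑ x ∈ t, (1 + ‖z.2‖) ^ N * ‖u (modulate (-z.2) (mulSchwartz (a x)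
        (mulSchwartz (g x) (compSubConstCLM ℂ z.1 (schwartzConj φ)))))‖ := by
        rw [mul_pow, mul_assoc, Finset.mul_sum]
    _ ≤ _ := by
        gcongr with x hx
        exact hC x z.1 z.2 (Set.mem_iInter₂.1 hz.2 x hx)

end WaveFront

end GaborWF

end

theorem mainTheorem2 {d : ℕ} (φ : 𝓢(GaborWF.Rd d, ℂ)) (hφ : φ ≠ 0)
    (u : 𝓢'(GaborWF.Rd d, ℂ))
    (hu : u ∈ GaborWF.compactlySupported d + GaborWF.schwartzFunctions d) :
    GaborWF.gaborWaveFrontSet φ u ⊆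
      ({0} : Set (GaborWF.Rd d)) ×ˢ (Prod.snd '' GaborWF.waveFrontSet u) := by
  obtain ⟨χ, f, hχ, hrep⟩ := GaborWF.exists_cutoff hu
  rintro ⟨x₀, ξ₀⟩ hz
  have hx₀ : x₀ = 0 := by
    by_contra hx
    exact GaborWF.notMem_gaborWaveFrontSet_of_fst_ne_zero hrep (z₀ := (x₀, ξ₀)) hx hz
  subst hx₀
  refine ⟨rfl, ?_⟩
  by_contra hξ
  have hξ₀ : ξ₀ ≠ 0 := fun h0 => hz.1 (by rw [h0]; rfl)
  refine GaborWF.notMem_gaborWaveFrontSet_of_forall_notMem_waveFrontSet hχ hrep hξ₀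
    (fun x hx => hξ ⟨(x, ξ₀), hx, rfl⟩) hz
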